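/- Identify the unit circle $\mathbb S$ with $\mathbb R/\mathbb Z$ and let $\sigma_3(t)=3t$. A *chord* $\overline{ab}$ is the closed segment joining $a,b\in\mathbb S$; it is degenerate (a point) if $a=b$. Put $\sigma_3(\overline{ab})=\overline{\sigma_3(a)\sigma_3(b)}$. A *lamination* is a set $\mathcal L$ of chords (leaves), no two distinct ones meeting inside the open unit disk $\mathbb D$, whose union $\mathcal L^*$ is closed. A *symmetric lamination* is a lamination $\mathcal L$ such that for every $\ell\in\mathcal L$: $\sigma_3(\ell)$ is a leaf or a point; $\ell=\sigma_3(\ell')$ for some $\ell'\in\mathcal L$; if $\sigma_3(\ell)$ is nondegenerate, then there are three pairwise disjoint leaves, one of them $\ell$, with image $\sigma_3(\ell)$; and $-\ell\in\mathcal L$. A *gap* $G$ is the closure of a component of $\mathbb D\setminus\mathcal L^*$; its vertices are the points of $G\cap\mathbb S$, its edges (sides) are the nondegenerate leaves contained in its boundary, and $\sigma_3(G)$ is the convex hull of $\sigma_3(G\cap\mathbb S)$. A *periodic polygon* is a gap $G$ with finitely many vertices such that $\sigma_3^k(G)=G$ for some $k\ge1$; if $k$ is the least such number, $g=\sigma_3^k$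 is the first return map of $G$. **Lemma.** Let $G$ be a periodic polygon of a symmetric lamination, and let $g$ be the first return map of $G$. One of the following is true. (a) The map $g$ acts on the sides of $G$ transitively as a rational rotation: if $v_i$, $i\in\mathbb Z/n$, are the vertices of $G$ in counterclockwise order, so that the sides are $\overline{v_iv_{i+1}}$, then for some $p$ the map $g$ sends each $v_i$ to $v_{i+p}$, and the sides form a single periodic orbit of $g$. (b) The edges of $G$ form two disjoint periodic orbits under $g$, $g$ permutes the sides of $G$ transitively in each orbit, and $G$ eventually maps to the gap $-G$ (that is, $\sigma_3^j(G)=-G$ for some $j\ge1$). If $\ell$ and $\ell'$ are two adjacent edges of $G$ (distinct edges with a common endpoint), then $\ell$ eventually maps to the edge $-\ell'$ of $-G$: for some $j\ge 1$ we have $\sigma_3^j(G)=-G$ and $\sigma_3^j(\ell)=-\ell'$. -/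

import Mathlib

open scoped Pointwise

noncomputable section

namespace CubicLam

/-- The `d`-tupling map `z ↦ z ^ d` of the unit circle
(`t ↦ d t` in the angular coordinate `ℝ / ℤ`). -/
def sigma (d : ℕ) : Circle → Circle := fun z => z ^ d

/-- The convex hull in the plane of a set of points of the circle. -/
def hull (A : Set Circle) : Set ℂ := convexHull ℝ ((fun z : Circle => (z : ℂ)) '' A)

/-- A chord is given by its unordered pair of endpoints; `chord e` is the corresponding closed
segment. The chord is degenerate (one point of the circle) when `e.IsDiag`. -/
def chord (e : Sym2 Circle) : Set ℂ := hull {z | z ∈ e}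

/-- The image of a chord: the chord spanned by the images of the endpoints. -/
def sigmaChord (d : ℕ) : Sym2 Circle → Sym2 Circle := Sym2.map (sigma d)

/-- The rotation of a chord by 180 degrees about the origin. -/
def negChord : Sym2 Circle → Sym2 Circle := Sym2.map (fun z => -z)

/-- Two distinct chords cross when they meet inside the open unit disk. -/
def Cross (e e' : Sym2 Circle) : Prop :=
  e ≠ e' ∧ (chord e ∩ chord e' ∩ Metric.ball (0 : ℂ) 1).Nonempty

/-- The union of all leaves. -/
def support (L : Set (Sym2 Circle)) : Set ℂ := ⋃ e ∈ L, chord e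

/-- A lamination: a set of pairwise non-crossing (possibly degenerate) chords
with closed union. -/
structure IsLamination (L : Set (Sym2 Circle)) : Prop where
  not_cross : ∀ e ∈ L, ∀ e' ∈ L, ¬ Cross e e'
  isClosed : IsClosed (support L)

/-- A `σ_d`-invariant lamination. -/
structure IsInvariantLamination (d : ℕ) (L : Set (Sym2 Circle)) : Prop extends
    IsLamination L where
  forward : ∀ e ∈ L, sigmaChord d e ∈ L ∨ (sigmaChord d e).IsDiag
  backward : ∀ e ∈ L, ∃ e' ∈ L, sigmaChord d e' = e
  siblings : ∀ e ∈ L, ¬ (sigmaChord d e).IsDiag →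
    ∃ f : Fin d → Sym2 Circle, (∃ i, f i = e) ∧ (∀ i, f i ∈ L) ∧
      (∀ i, sigmaChord d (f i) = sigmaChord d e) ∧
      (∀ i j, i ≠ j → Disjoint (chord (f i)) (chord (f j)))

/-- A symmetric (cubic) lamination. -/
structure IsSymmetricLamination (L : Set (Sym2 Circle)) : Prop extends
    IsInvariantLamination 3 L where
  symm : ∀ e ∈ L, negChord e ∈ L

/-- A gap: the closure of a component of the open unit disk minus the union of the leaves. -/
def IsGap (L : Set (Sym2 Circle)) (G : Set ℂ) : Prop :=
  ∃ z ∈ Metric.ball (0 : ℂ) 1 \ support L,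
    G = closure (connectedComponentIn (Metric.ball (0 : ℂ) 1 \ support L) z)

/-- The vertices of `G`: its points on the unit circle. -/
def vertices (G : Set ℂ) : Set Circle := {z | (z : ℂ) ∈ G}

/-- The edges (sides) of `G`: the nondegenerate leaves contained in the boundary of `G`. -/
def edges (L : Set (Sym2 Circle)) (G : Set ℂ) : Set (Sym2 Circle) :=
  {e | e ∈ L ∧ ¬ e.IsDiag ∧ chord e ⊆ frontier G}

/-- The image of a gap: the convex hull of the images of its vertices. -/
def sigmaGap (d : ℕ) (G : Set ℂ) : Set ℂ := hull (sigma d '' vertices G)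

/-- A periodic polygon: a gap with finitely many vertices which some positive iterate of `σ₃`
maps to itself. -/
structure IsPeriodicPolygon (L : Set (Sym2 Circle)) (G : Set ℂ) : Prop where
  isGap : IsGap L G
  finite : (vertices G).Finite
  periodic : ∃ k : ℕ, 0 < k ∧ (sigmaGap 3)^[k] G = G

/-- The first return map of a periodic gap: the iterate of `σ₃` whose exponent is the
minimal period of the gap. -/
def firstReturn (G : Set ℂ) : Circle → Circle :=
  (sigma 3)^[Function.minimalPeriod (sigmaGap 3) G]

/-- The map on chords induced by the first return map. -/
def firstReturnChord (G : Set ℂ) : Sym2 Circle → Sym2 Circle := Sym2.map (firstReturn G)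

/-- `O` is nonempty, is permuted by `f`, and `f` is transitive on `O`;
that is, `O` is a single periodic orbit of `f`. -/
def IsPeriodicOrbit {α : Type*} (f : α → α) (O : Set α) : Prop :=
  O.Nonempty ∧ Set.BijOn f O O ∧ ∀ a ∈ O, ∀ b ∈ O, ∃ j : ℕ, f^[j] a = b

/-- `g` acts on the polygon `G` as a rational rotation. The `n` vertices of `G` are
`v i = exp (θ i)`, `i` mod `n`, in counterclockwise order; the sides of `G` are the chords
`v i, v (i + 1)`; and for some `p` the map `g` sends each `v i` to `v (i + p)`, hence the `i`-th
side to the `(i + p)`-th side (rotation by `p / n` of a full turn). -/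
def ActsAsRationalRotation (L : Set (Sym2 Circle)) (G : Set ℂ) (g : Circle → Circle) : Prop :=
  ∃ (n : ℕ) (p : ℤ) (θ : ℤ → ℝ), 0 < n ∧ StrictMono θ ∧
    (∀ i, θ (i + n) = θ i + 2 * Real.pi) ∧
    vertices G = Set.range (fun i => Circle.exp (θ i)) ∧
    edges L G = Set.range (fun i => s(Circle.exp (θ i), Circle.exp (θ (i + 1)))) ∧
    ∀ i, g (Circle.exp (θ i)) = Circle.exp (θ (i + p))

/-- Two edges are adjacent when they are distinct and share an endpoint. -/
def Adjacent (e e' : Sym2 Circle) : Prop := e ≠ e' ∧ ∃ v, v ∈ e ∧ v ∈ e'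

end CubicLam

end

noncomputable section

namespace CubicLam

/-! A periodic gap is the convex hull of its vertices, so its sides are the leaves joining
consecutive vertices (`mem_edges_iff`). Tripling respects the cyclic order of the vertices; counting
siblings proves this for adjacent leaves (`arc_sigma_le`), and non-crossing of image leaves does the
rest (`cons_sigma`). As `σ₃` commutes with `z ↦ -z`, the maps `± σ₃ᵗ` that preserve the vertex set
`V` form a group of permutations of `V` respecting the cyclic order, and such a map is the identity
as soon as it fixes one vertex (`tau_eq_self`).

The heart is that this group is transitive on `V` (`IsPolygon.equivalent`). The powers of `g` then
have one or two orbits. One orbit is (a). With two, no vertex is carried to the next one by a power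
of `g`, since otherwise every vertex would be carried to every other; so some `-σ₃ᵗ` does it, and
this is (b).

Transitivity comes from lengths, measured by the shorter arc. A length up to `1/6` is tripled, and
`x` in `[1/6, 1/2]` becomes `3|x - 1/3|`. So the shortest chord in the orbit of a side is the image
of a leaf of length `x > 1/6` (`exists_min_len`). If `x < 1/2`, this leaf and a sibling bound a
strip around critical chords, and the strip and its negative trap every leaf at least as close to
length `1/3` (`exists_strip`, `arc_sigma_le_of_strip`). Let `u` start the side whose orbit contains
the shortest chord of all, let `Q` be the image of `V` containing that chord, and let `v` be a
vertex not equivalent to `u`. Then `Q` lies under the shortest chord of the orbit of the side at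
`v`, up to sign, so the image of that side in `Q` must face the rest of the circle and span at least
half of it (`exists_shortest`). A polygon has at most one such side, so at most one vertex is not
equivalent to `u`. A group element carrying `u` to a third vertex would fix that exceptional vertex
without being the identity, which is impossible. -/

/-! ### Angular coordinates and oriented arcs -/

/-- The point of the circle with angular coordinate `t ∈ ℝ / ℤ`. -/
def turn (t : ℝ) : Circle := Circle.exp (2 * Real.pi * t)

lemma turn_add (s t : ℝ) : turn (s + t) = turn s * turn t := by
  simp [turn, mul_add, Circle.exp_add]

lemma turn_sub (s t : ℝ) : turn (s - t) = turn s / turn t := by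
  simp [turn, mul_sub]

@[simp] lemma turn_zero : turn 0 = 1 := by simp [turn]

lemma turn_int (n : ℤ) : turn n = 1 := Circle.exp_two_pi_mul_int n

lemma turn_eq_turn {s t : ℝ} : turn s = turn t ↔ ∃ m : ℤ, s = t + m := by
  have hp := Real.pi_pos
  rw [turn, turn, Circle.exp_eq_exp]
  refine exists_congr fun m => ⟨fun h => ?_, fun h => by rw [h]; ring⟩
  have : 2 * Real.pi * (s - (t + m)) = 0 := by linarith
  rcases mul_eq_zero.1 this with h | h <;> linarith

lemma turn_fract (t : ℝ) : turn (Int.fract t) = turn t :=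
  turn_eq_turn.2 ⟨-⌊t⌋, by rw [Int.fract]; push_cast; ring⟩

lemma turn_pow (t : ℝ) (n : ℕ) : turn t ^ n = turn (n * t) := by
  rw [turn, turn, ← Circle.exp_natCast_mul]; congr 1; ring

lemma turn_half : turn (1 / 2) = -1 := by
  rw [turn, show 2 * Real.pi * (1 / 2) = Real.pi by ring]
  ext
  simp [Circle.coe_exp]

lemma exists_turn_eq (z : Circle) : ∃ t, 0 ≤ t ∧ t < 1 ∧ turn t = z := by
  obtain ⟨x, rfl⟩ := Circle.exp_surjective z
  refine ⟨Int.fract (x / (2 * Real.pi)), Int.fract_nonneg _, Int.fract_lt_one _, ?_⟩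
  rw [turn_fract, turn]; congr 1; field_simp

/-- The length, in turns, of the positively oriented arc from `a` to `b`. -/
def arc (a b : Circle) : ℝ := (exists_turn_eq (b / a)).choose

lemma arc_nonneg (a b : Circle) : 0 ≤ arc a b := (exists_turn_eq (b / a)).choose_spec.1

lemma arc_lt_one (a b : Circle) : arc a b < 1 := (exists_turn_eq (b / a)).choose_spec.2.1

lemma turn_arc (a b : Circle) : turn (arc a b) = b / a :=
  (exists_turn_eq (b / a)).choose_spec.2.2

lemma mul_turn_arc (a b : Circle) : a * turn (arc a b) = b := by
  rw [turn_arc]; exact mul_div_cancel a b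

lemma eq_of_turn_eq {s t : ℝ} (hs : 0 ≤ s) (hs' : s < 1) (ht : 0 ≤ t) (ht' : t < 1)
    (h : turn s = turn t) : s = t := by
  obtain ⟨m, hm⟩ := turn_eq_turn.1 h
  have h1 : (m : ℝ) < 1 := by linarith
  have h2 : (-1 : ℝ) < m := by linarith
  have h3 : m < 1 := by exact_mod_cast h1
  have h4 : -1 < m := by exact_mod_cast h2
  have : m = 0 := by omega
  simpa [this] using hm

lemma arc_mul_turn (a : Circle) (t : ℝ) : arc a (a * turn t) = Int.fract t := by
  refine eq_of_turn_eq (arc_nonneg _ _) (arc_lt_one _ _) (Int.fract_nonneg _)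
    (Int.fract_lt_one _) ?_
  rw [turn_arc, turn_fract]; exact mul_div_cancel_left a _

lemma arc_mul_turn_of_lt (a : Circle) {t : ℝ} (h0 : 0 ≤ t) (h1 : t < 1) :
    arc a (a * turn t) = t := by
  rw [arc_mul_turn, Int.fract_eq_self.2 ⟨h0, h1⟩]

lemma arc_right_injective (a : Circle) {b c : Circle} (h : arc a b = arc a c) : b = c := by
  rw [← mul_turn_arc a b, h, mul_turn_arc]

@[simp] lemma arc_self (a : Circle) : arc a a = 0 := by
  have := arc_mul_turn a 0
  simpa using this

lemma arc_eq_zero {a b : Circle} : arc a b = 0 ↔ a = b :=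
  ⟨fun h => arc_right_injective a (by rw [h, arc_self]), fun h => by rw [h, arc_self]⟩

lemma arc_pos {a b : Circle} (h : a ≠ b) : 0 < arc a b :=
  lt_of_le_of_ne (arc_nonneg _ _) fun h' => h (arc_eq_zero.1 h'.symm)

lemma ne_of_arc_pos {a b : Circle} (h : 0 < arc a b) : a ≠ b := by
  rintro rfl; simp at h

/-- Change of base point: all arcs can be expressed in one coordinate with origin `r`, where
comparing them is linear arithmetic. -/
lemma arc_eq_fract (r a b : Circle) : arc a b = Int.fract (arc r b - arc r a) := by
  rw [← arc_mul_turn a, turn_sub, turn_arc, turn_arc, div_div_div_cancel_right,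
    mul_div_cancel]

lemma arc_eq_sub {r a b : Circle} (h : arc r a ≤ arc r b) : arc a b = arc r b - arc r a := by
  rw [arc_eq_fract r, Int.fract_eq_self.2]
  exact ⟨by linarith, by linarith [arc_nonneg r a, arc_lt_one r b]⟩

lemma arc_eq_sub_add_one {r a b : Circle} (h : arc r b < arc r a) :
    arc a b = arc r b - arc r a + 1 := by
  rw [arc_eq_fract r, ← Int.fract_add_one, Int.fract_eq_self.2]
  exact ⟨by linarith [arc_nonneg r b, arc_lt_one r a], by linarith⟩

lemma arc_add_arc {a b : Circle} (h : a ≠ b) : arc a b + arc b a = 1 := by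
  rw [arc_eq_sub_add_one (r := a) (a := b) (b := a)]
  · simp
  · simpa using arc_pos h

@[simp] lemma arc_mul_left (c a b : Circle) : arc (c * a) (c * b) = arc a b := by
  refine eq_of_turn_eq (arc_nonneg _ _) (arc_lt_one _ _) (arc_nonneg _ _) (arc_lt_one _ _) ?_
  rw [turn_arc, turn_arc, mul_div_mul_left_eq_div]

@[simp] lemma arc_neg (a b : Circle) : arc (-a) (-b) = arc a b := by
  rw [← neg_one_mul a, ← neg_one_mul b, arc_mul_left]

lemma sigma_mul_turn (a : Circle) (t : ℝ) : sigma 3 (a * turn t) = sigma 3 a * turn (3 * t) := by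
  simp only [sigma, mul_pow, turn_pow]; norm_num

lemma arc_sigma (a b : Circle) : arc (sigma 3 a) (sigma 3 b) = Int.fract (3 * arc a b) := by
  conv_lhs => rw [← mul_turn_arc a b, sigma_mul_turn, arc_mul_turn]

lemma neg_eq_mul_turn (a : Circle) : -a = a * turn (1 / 2) := by
  rw [turn_half, mul_neg_one]

/-! ### Orientation of triples of points of the plane -/

/-- Twice the signed area of the triangle `a b c`. -/
def area (a b c : ℂ) : ℝ := (b.re - a.re) * (c.im - a.im) - (b.im - a.im) * (c.re - a.re)

lemma area_rot (a b c : ℂ) : area b c a = area a b c := by simp only [area]; ring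

lemma area_swap (a b c : ℂ) : area b a c = -area a b c := by simp only [area]; ring

lemma continuous_area (a b : ℂ) : Continuous (area a b) := by
  unfold area
  fun_prop

lemma area_combo (a b x y : ℂ) {s t : ℝ} (h : s + t = 1) :
    area a b (s • x + t • y) = s * area a b x + t * area a b y := by
  obtain rfl : s = 1 - t := by linarith
  simp [area]
  ring

/-- The product form shows the sign: each factor is positive when the three angles increase within
one turn. -/
lemma area_exp (α β γ : ℝ) : area (Circle.exp α) (Circle.exp β) (Circle.exp γ) =
    4 * Real.sin ((β - α) / 2) * Real.sin ((γ - β) / 2) * Real.sin ((γ - α) / 2) := by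
  have hre : ∀ x : ℝ, (Circle.exp x : ℂ).re = Real.cos x := fun x => by
    rw [Circle.coe_exp, Complex.exp_ofReal_mul_I_re]
  have him : ∀ x : ℝ, (Circle.exp x : ℂ).im = Real.sin x := fun x => by
    rw [Circle.coe_exp, Complex.exp_ofReal_mul_I_im]
  simp only [area, hre, him]
  obtain ⟨x, rfl⟩ : ∃ x, β = α + 2 * x := ⟨(β - α) / 2, by ring⟩
  obtain ⟨y, rfl⟩ : ∃ y, γ = α + 2 * x + 2 * y := ⟨(γ - (α + 2 * x)) / 2, by ring⟩
  rw [show (α + 2 * x - α) / 2 = x by ring, show (α + 2 * x + 2 * y - (α + 2 * x)) / 2 = y by ring,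
    show (α + 2 * x + 2 * y - α) / 2 = x + y by ring]
  have e : ∀ a b c : ℝ, (Real.cos b - Real.cos a) * (Real.sin c - Real.sin a) -
      (Real.sin b - Real.sin a) * (Real.cos c - Real.cos a) =
      Real.sin (c - b) + Real.sin (b - a) - Real.sin (c - a) := fun a b c => by
    rw [Real.sin_sub, Real.sin_sub, Real.sin_sub]; ring
  rw [e, show α + 2 * x + 2 * y - (α + 2 * x) = 2 * y by ring,
    show α + 2 * x - α = 2 * x by ring, show α + 2 * x + 2 * y - α = 2 * x + 2 * y by ring,
    Real.sin_add (2 * x), Real.sin_two_mul, Real.sin_two_mul, Real.cos_two_mul, Real.cos_two_mul,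
    Real.sin_add]
  have h1 := Real.sin_sq_add_cos_sq x
  have h2 := Real.sin_sq_add_cos_sq y
  linear_combination (-4 * Real.sin x * Real.cos x) * h2 + (-4 * Real.sin y * Real.cos y) * h1

lemma area_pos {r a b c : Circle} (h1 : arc r a < arc r b) (h2 : arc r b < arc r c) :
    0 < area a b c := by
  have hp := Real.pi_pos
  have key : ∀ z : Circle, z = Circle.exp (Complex.arg r + 2 * Real.pi * arc r z) := fun z => by
    conv_lhs => rw [← mul_turn_arc r z]
    rw [Circle.exp_add, Circle.exp_arg, turn]
  rw [key a, key b, key c, area_exp]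
  have ha := arc_nonneg r a
  have hc := arc_lt_one r c
  refine mul_pos (mul_pos (mul_pos (by norm_num) ?_) ?_) ?_ <;>
    refine Real.sin_pos_of_pos_of_lt_pi ?_ ?_ <;> nlinarith

/-! ### Chords as segments, and crossing -/

lemma chord_eq_segment (a b : Circle) : chord s(a, b) = segment ℝ (a : ℂ) (b : ℂ) := by
  have : (fun z : Circle => (z : ℂ)) '' {z | z ∈ s(a, b)} = {(a : ℂ), (b : ℂ)} := by
    ext z
    simp only [Sym2.mem_iff, Set.mem_image, Set.mem_ofPred_eq, Set.mem_insert_iff,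
      Set.mem_singleton_iff]
    constructor
    · rintro ⟨x, rfl | rfl, rfl⟩ <;> simp
    · rintro (rfl | rfl)
      exacts [⟨a, Or.inl rfl, rfl⟩, ⟨b, Or.inr rfl, rfl⟩]
  rw [chord, hull, this, convexHull_pair]

lemma openSegment_mem_ball {a b : Circle} (h : a ≠ b) {s t : ℝ} (hs : 0 < s) (ht : 0 < t)
    (hst : s + t = 1) : s • (a : ℂ) + t • (b : ℂ) ∈ Metric.ball (0 : ℂ) 1 := by
  have := (strictConvex_closedBall ℝ (0 : ℂ) 1) (x := a)
    (by simp [Circle.norm_coe]) (y := b) (by simp [Circle.norm_coe])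
    (fun e => h (Circle.ext e)) hs ht hst
  rwa [interior_closedBall _ one_ne_zero] at this

/-- The crossing point is explicit: its barycentric coordinates on each chord are ratios of areas of
triangles on the four endpoints. -/
lemma cross_of_linked {r a b c e : Circle} (h1 : arc r a < arc r c) (h2 : arc r c < arc r b)
    (h3 : arc r b < arc r e) : Cross s(a, b) s(c, e) := by
  have p1 : 0 < area a c b := area_pos h1 h2
  have p2 : 0 < area a b e := area_pos (h1.trans h2) h3
  have p3 : 0 < area a c e := area_pos h1 (h2.trans h3)
  have p4 : 0 < area c b e := area_pos h2 h3
  have hab : a ≠ b := by rintro rfl; linarith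
  refine ⟨fun h => ?_, ?_⟩
  · have : c ∈ s(a, b) := by rw [h]; simp
    rcases Sym2.mem_iff.1 this with rfl | rfl <;> linarith
  have hD : 0 < area a c e + area c b e := by linarith
  have hE : area a c b + area a b e = area a c e + area c b e := by simp only [area]; ring
  set D := area a c e + area c b e with hDdef
  have q1 : area c b e / D + area a c e / D = 1 := by
    rw [← add_div, add_comm, ← hDdef, div_self hD.ne']
  have q2 : area a b e / D + area a c b / D = 1 := by
    rw [← add_div, add_comm, hE, div_self hD.ne']
  refine ⟨(area c b e / D) • (a : ℂ) + (area a c e / D) • (b : ℂ), ⟨?_, ?_⟩, ?_⟩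
  · rw [chord_eq_segment]
    exact ⟨_, _, by positivity, by positivity, q1, rfl⟩
  · rw [chord_eq_segment]
    refine ⟨area a b e / D, area a c b / D, by positivity, by positivity, q2, ?_⟩
    have hne := hD.ne'
    apply Complex.ext <;> simp <;> field_simp <;> simp only [area] <;> ring
  · exact openSegment_mem_ball hab (by positivity) (by positivity) q1

/-- Leaves of a lamination are not linked. -/
lemma IsLamination.not_linked {L : Set (Sym2 Circle)} (hL : IsLamination L) (r : Circle)
    {a b c e : Circle} (hab : s(a, b) ∈ L) (hce : s(c, e) ∈ L) (h1 : arc r a < arc r c)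
    (h2 : arc r c < arc r b) : arc r e ≤ arc r b := by
  by_contra! h3
  exact hL.not_cross _ hab _ hce (cross_of_linked h1 h2 h3)

variable {L : Set (Sym2 Circle)} {V : Set Circle} {G : Set ℂ} {N k : ℕ}

/-! ### Consecutive points of a finite subset of the circle -/

/-- `b` is the point of `V` that follows `a` in the positive direction. -/
structure Cons (V : Set Circle) (a b : Circle) : Prop where
  left_mem : a ∈ V
  right_mem : b ∈ V
  ne : a ≠ b
  le : ∀ c ∈ V, c ≠ a → arc a b ≤ arc a c

lemma arc_cases (r a b : Circle) : (arc r a ≤ arc r b ∧ arc a b = arc r b - arc r a) ∨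
    (arc r b < arc r a ∧ arc a b = arc r b - arc r a + 1) := by
  rcases le_or_gt (arc r a) (arc r b) with h | h
  · exact Or.inl ⟨h, arc_eq_sub h⟩
  · exact Or.inr ⟨h, arc_eq_sub_add_one h⟩

lemma exists_cons {V : Set Circle} (hV : V.Finite) {a c : Circle} (ha : a ∈ V) (hc : c ∈ V)
    (hac : c ≠ a) : ∃ b, Cons V a b := by
  obtain ⟨b, ⟨hb, hba⟩, hmin⟩ := Set.exists_min_image (V \ {a}) (arc a) (hV.sdiff) ⟨c, hc, hac⟩
  exact ⟨b, ha, hb, fun h => hba h.symm, fun d hd hda => hmin d ⟨hd, hda⟩⟩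

lemma exists_cons_left {V : Set Circle} (hV : V.Finite) {b c : Circle} (hb : b ∈ V)
    (hc : c ∈ V) (hbc : c ≠ b) : ∃ a, Cons V a b := by
  obtain ⟨a, ⟨ha, hab⟩, hmin⟩ := Set.exists_min_image (V \ {b}) (fun z => arc z b) (hV.sdiff)
    ⟨c, hc, hbc⟩
  refine ⟨a, ha, hb, hab, fun d hd hda => ?_⟩
  by_contra! hlt
  have hdb : d ≠ b := by rintro rfl; exact lt_irrefl _ hlt
  have h1 := hmin d ⟨hd, hdb⟩
  have h2 := arc_pos (Ne.symm hda)
  rw [arc_eq_sub hlt.le] at h1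
  linarith

lemma Cons.right_unique {V : Set Circle} {a b c : Circle} (h : Cons V a b) (h' : Cons V a c) :
    b = c :=
  arc_right_injective a (le_antisymm (h.le c h'.right_mem h'.ne.symm)
    (h'.le b h.right_mem h.ne.symm))

lemma Cons.left_unique {V : Set Circle} {a b c : Circle} (h : Cons V a c) (h' : Cons V b c) :
    a = b := by
  by_contra hab
  have h1 := h.le b h'.left_mem (Ne.symm hab)
  have h2 := h'.le a h.left_mem hab
  have h3 := arc_add_arc hab
  have h4 := arc_pos h.ne
  have h5 : arc a c ≠ arc a b := fun e => h'.ne (arc_right_injective a e).symm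
  rcases arc_cases a b c with ⟨h6, h7⟩ | ⟨h6, h7⟩
  · exact h5 (le_antisymm h1 h6)
  · linarith

/-- A finite set of at least three points whose consecutive points are joined by leaves. -/
structure IsPrePolygon (L : Set (Sym2 Circle)) (V : Set Circle) : Prop where
  finite : V.Finite
  three : ∀ a b, ∃ c ∈ V, c ≠ a ∧ c ≠ b
  leaf : ∀ a b, Cons V a b → s(a, b) ∈ L

/-- A finite set of at least three points such that the leaves joining two of its points are
exactly the ones that join consecutive points. -/
structure IsPolygon (L : Set (Sym2 Circle)) (V : Set Circle) : Prop extends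
    IsPrePolygon L V where
  diag : ∀ a ∈ V, ∀ b ∈ V, a ≠ b → s(a, b) ∈ L → Cons V a b ∨ Cons V b a

lemma IsPrePolygon.exists_next (hV : IsPrePolygon L V) {a : Circle} (ha : a ∈ V) :
    ∃ b, Cons V a b := by
  obtain ⟨c, hc, hca, -⟩ := hV.three a a
  exact exists_cons hV.finite ha hc hca

lemma IsPrePolygon.exists_prev (hV : IsPrePolygon L V) {b : Circle} (hb : b ∈ V) :
    ∃ a, Cons V a b := by
  obtain ⟨c, hc, hca, -⟩ := hV.three b b
  exact exists_cons_left hV.finite hb hc hca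

lemma IsPrePolygon.not_cons_swap (hV : IsPrePolygon L V) {a b : Circle} (h : Cons V a b) :
    ¬ Cons V b a := by
  intro h'
  obtain ⟨c, hc, hca, hcb⟩ := hV.three a b
  have h1 := h.le c hc hca
  have h2 := h'.le c hc hcb
  have h3 := arc_add_arc h.ne
  have h4 := arc_pos h.ne
  have h5 : arc a b ≠ arc a c := fun e => hcb (arc_right_injective a e).symm
  have h6 := arc_lt_one a c
  rw [arc_eq_sub h1] at h2
  linarith

/-! ### Orientation -/

/-- The three preimages of a point have coordinates `(x + j) / 3`, `j = 0, 1, 2`; questions about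
siblings become questions about these integers. -/
lemma exists_int_of_arc_sigma {a b : Circle} {x : ℝ} (h : arc (sigma 3 a) (sigma 3 b) = x) :
    ∃ j : ℤ, 3 * arc a b = x + j ∧ 0 ≤ j ∧ j ≤ 2 := by
  rw [arc_sigma] at h
  have h0 := arc_nonneg a b
  have h1 := arc_lt_one a b
  refine ⟨⌊3 * arc a b⌋, by rw [← h]; exact (Int.fract_add_floor _).symm,
    Int.floor_nonneg.2 (by linarith), ?_⟩
  have : ⌊3 * arc a b⌋ < 3 := Int.floor_lt.2 (by push_cast; linarith)
  omega

lemma not_disjoint_chord {a b c e : Circle} (h : a = c ∨ a = e ∨ b = c ∨ b = e) :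
    ¬ Disjoint (chord s(a, b)) (chord s(c, e)) := by
  rw [chord_eq_segment, chord_eq_segment, Set.not_disjoint_iff]
  rcases h with rfl | rfl | rfl | rfl
  · exact ⟨a, left_mem_segment _ _ _, left_mem_segment _ _ _⟩
  · exact ⟨a, left_mem_segment _ _ _, right_mem_segment _ _ _⟩
  · exact ⟨b, right_mem_segment _ _ _, left_mem_segment _ _ _⟩
  · exact ⟨b, right_mem_segment _ _ _, right_mem_segment _ _ _⟩

/-- The siblings of a leaf, with their endpoints ordered according to their images. -/
lemma IsInvariantLamination.exists_siblings (hL : IsInvariantLamination 3 L) {a b : Circle}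
    (hab : s(a, b) ∈ L) (hne : sigma 3 a ≠ sigma 3 b) :
    ∃ (x y : Fin 3 → Circle) (i₀ : Fin 3), x i₀ = a ∧ y i₀ = b ∧
      (∀ i, s(x i, y i) ∈ L ∧ sigma 3 (x i) = sigma 3 a ∧ sigma 3 (y i) = sigma 3 b) ∧
      ∀ i j, i ≠ j → Disjoint (chord s(x i, y i)) (chord s(x j, y j)) := by
  obtain ⟨f, ⟨i₀, hi₀⟩, hf, hσ, hd⟩ := hL.siblings _ hab (by simpa [sigmaChord] using hne)
  have : ∀ i, ∃ x y, f i = s(x, y) ∧ sigma 3 x = sigma 3 a ∧ sigma 3 y = sigma 3 b := by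
    intro i
    have h := hσ i
    induction hfi : f i using Sym2.ind with
    | _ x y =>
      rw [hfi] at h
      simp only [sigmaChord, Sym2.map_mk] at h
      rcases Sym2.eq_iff.1 h with h | h
      · exact ⟨x, y, rfl, h⟩
      · exact ⟨y, x, Sym2.eq_swap, h.2, h.1⟩
  choose x y hxy hx hy using this
  refine ⟨x, y, i₀, ?_, ?_, fun i => ⟨hxy i ▸ hf i, hx i, hy i⟩, fun i j hij => ?_⟩
  · rcases Sym2.eq_iff.1 ((hxy i₀).symm.trans hi₀) with h | h
    · exact h.1
    · exact absurd ((hx i₀).symm.trans (congrArg _ h.1)) hne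
  · rcases Sym2.eq_iff.1 ((hxy i₀).symm.trans hi₀) with h | h
    · exact h.2
    · exact absurd ((hx i₀).symm.trans (congrArg _ h.1)) hne
  · rw [← hxy, ← hxy]; exact hd i j hij

/-- The tripling map preserves the orientation of two adjacent leaves. -/
lemma IsInvariantLamination.arc_sigma_le (hL : IsInvariantLamination 3 L) {a b c : Circle}
    (hab : s(a, b) ∈ L) (hbc : s(b, c) ∈ L) (h : arc b c < arc b a)
    (h1 : sigma 3 a ≠ sigma 3 b) (h2 : sigma 3 b ≠ sigma 3 c)
    (h3 : sigma 3 a ≠ sigma 3 c) : arc (sigma 3 a) (sigma 3 b) ≤ arc (sigma 3 a) (sigma 3 c) := by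
  by_contra! hlt
  have hα := arc_add_arc h1
  have hαpos := arc_pos h1.symm
  have hα1 := arc_lt_one (sigma 3 b) (sigma 3 a)
  have hγ0 := arc_pos h2
  have hγ1 := arc_lt_one (sigma 3 b) (sigma 3 c)
  -- Reversed orientation of the images, read from the base point `σ₃ b`.
  have hαγ : arc (sigma 3 b) (sigma 3 a) < arc (sigma 3 b) (sigma 3 c) := by
    rcases arc_cases (sigma 3 b) (sigma 3 a) (sigma 3 c) with ⟨e1, e2⟩ | ⟨e1, e2⟩
    · exact lt_of_le_of_ne e1 fun e => h3 (arc_right_injective _ e)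
    · linarith
  obtain ⟨x, y, i₀, hx₀, hy₀, hxy, hd⟩ := hL.exists_siblings hab h1
  have hj : ∀ i, ∃ j : ℤ, 3 * arc b (x i) = arc (sigma 3 b) (sigma 3 a) + j ∧ 0 ≤ j ∧ j ≤ 2 :=
    fun i => exists_int_of_arc_sigma (by rw [(hxy i).2.1])
  have hk : ∀ i, ∃ k : ℤ, 3 * arc b (y i) = 0 + k ∧ 0 ≤ k ∧ k ≤ 2 :=
    fun i => exists_int_of_arc_sigma (by rw [(hxy i).2.2, arc_self])
  obtain ⟨m, hm, hm0, hm2⟩ := exists_int_of_arc_sigma (rfl : arc (sigma 3 b) (sigma 3 c) = _)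
  choose j hj hj0 hj2 using hj
  choose k hk hk0 hk2 using hk
  have hjinj : ∀ i i', i ≠ i' → j i ≠ j i' := fun i i' hi e =>
    not_disjoint_chord (Or.inl (arc_right_injective b
      (by have := hj i; have := hj i'; rw [e] at *; linarith))) (hd i i' hi)
  have hkinj : ∀ i i', i ≠ i' → k i ≠ k i' := fun i i' hi e =>
    not_disjoint_chord (Or.inr (Or.inr (Or.inr (arc_right_injective b
      (by have := hk i; have := hk i'; rw [e] at *; linarith))))) (hd i i' hi)
  have hk₀ : k i₀ = 0 := by
    have := hk i₀
    rw [hy₀, arc_self] at this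
    exact_mod_cast (by linarith : (k i₀ : ℝ) = 0)
  have hj₀ : m < j i₀ := by
    have := hj i₀
    rw [hx₀] at this
    exact_mod_cast (by linarith : (m : ℝ) < j i₀)
  -- A sibling starting strictly under the leaf `b c` must end under it. All of `0, ..., m` occur as
  -- values of `j`, so `m + 1` siblings have `k ≤ m`; but `k = 0` is taken by the leaf `a b` itself,
  -- for which `j > m`. Only `m` values remain for them.
  have hle : ∀ i, j i ≤ m → k i ≤ m := by
    intro i hi
    have hi' : (j i : ℝ) ≤ m := by exact_mod_cast hi
    have hi0 : (0 : ℝ) ≤ j i := by exact_mod_cast hj0 i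
    have := hL.not_linked b hbc (hxy i).1 (by rw [arc_self]; linarith [hj i])
      (by linarith [hj i])
    have h4 : (k i : ℝ) < m + 1 := by linarith [hk i]
    have : k i < m + 1 := by exact_mod_cast h4
    omega
  have a01 := hjinj 0 1 (by decide)
  have a02 := hjinj 0 2 (by decide)
  have a12 := hjinj 1 2 (by decide)
  have b01 := hkinj 0 1 (by decide)
  have b02 := hkinj 0 2 (by decide)
  have b12 := hkinj 1 2 (by decide)
  have c0 := hle 0
  have c1 := hle 1
  have c2 := hle 2
  have := hj0 0
  have := hj0 1
  have := hj0 2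
  have := hj2 0
  have := hj2 1
  have := hj2 2
  have := hk0 0
  have := hk0 1
  have := hk0 2
  clear hj hk hxy hd hle hjinj hkinj hj0 hj2 hk0 hk2
  fin_cases i₀ <;> simp only [Fin.mk_zero, Fin.mk_one, Fin.reduceFinMk] at hk₀ hj₀ <;>
    omega

lemma IsInvariantLamination.leaf_sigma (hL : IsInvariantLamination 3 L) {a b : Circle}
    (hab : s(a, b) ∈ L) (hne : sigma 3 a ≠ sigma 3 b) : s(sigma 3 a, sigma 3 b) ∈ L := by
  rcases hL.forward _ hab with h | h
  · exact h
  · exact absurd (by simpa [sigmaChord] using h) hne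

/-- The tripling map sends consecutive vertices to consecutive vertices. -/
lemma IsPrePolygon.cons_sigma (hV : IsPrePolygon L V) (hL : IsInvariantLamination 3 L)
    (hinj : Set.InjOn (sigma 3) V) {a b : Circle} (h : Cons V a b) :
    Cons (sigma 3 '' V) (sigma 3 a) (sigma 3 b) := by
  have hne : ∀ {u w}, u ∈ V → w ∈ V → u ≠ w → sigma 3 u ≠ sigma 3 w :=
    fun hu hw huw e => huw (hinj hu hw e)
  refine ⟨⟨a, h.left_mem, rfl⟩, ⟨b, h.right_mem, rfl⟩, hne h.left_mem h.right_mem h.ne, ?_⟩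
  by_contra! hbad
  obtain ⟨_, ⟨z₀, hz₀, rfl⟩, hz₀a, hz₀b⟩ := hbad
  -- The first vertex after `b` whose image falls between those of `a` and `b`. If its predecessor
  -- `y` is `b`, adjacent leaves reverse orientation; otherwise `y` has its image outside that arc,
  -- and the image leaves cross.
  obtain ⟨z, ⟨hz, hza, hzb⟩, hmin⟩ := Set.exists_min_image
    {z | z ∈ V ∧ z ≠ a ∧ arc (sigma 3 a) (sigma 3 z) < arc (sigma 3 a) (sigma 3 b)} (arc b)
    (hV.finite.subset fun z hz => hz.1) ⟨z₀, hz₀, fun e => hz₀a (by rw [e]), hz₀b⟩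
  have hzb' : z ≠ b := by rintro rfl; exact lt_irrefl _ hzb
  obtain ⟨y, hy⟩ := hV.exists_prev hz
  have hab := hL.leaf_sigma (hV.leaf _ _ h) (hne h.left_mem h.right_mem h.ne)
  have hyz := hL.leaf_sigma (hV.leaf _ _ hy) (hne hy.left_mem hy.right_mem hy.ne)
  have hpos := arc_pos (hne h.left_mem hz hza.symm)
  rcases eq_or_ne y b with rfl | hyb
  · refine absurd hzb (not_lt.2 (hL.arc_sigma_le (hV.leaf _ _ h) (hV.leaf _ _ hy) ?_
      (hne h.left_mem h.right_mem h.ne) (hne h.right_mem hz hzb'.symm)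
      (hne h.left_mem hz hza.symm)))
    exact lt_of_le_of_ne (hy.le a h.left_mem h.ne) fun e => hza (arc_right_injective _ e)
  · have hya : y ≠ a := by rintro rfl; exact hzb' (hy.right_unique h)
    have hylt : arc b y < arc b z := by
      by_contra! hle
      have h1 := hy.le b h.right_mem hyb.symm
      rcases arc_cases b y z with ⟨e1, e2⟩ | ⟨e1, e2⟩
      · exact hy.ne (arc_right_injective _ (le_antisymm e1 hle))
      · have := arc_add_arc hyb
        have := arc_pos hzb'.symm
        linarith
    have hynb : arc (sigma 3 a) (sigma 3 b) ≤ arc (sigma 3 a) (sigma 3 y) := by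
      by_contra! hlt
      exact absurd (hmin y ⟨hy.left_mem, hya, hlt⟩) (not_le.2 hylt)
    have hynb' : arc (sigma 3 a) (sigma 3 y) ≠ arc (sigma 3 a) (sigma 3 b) := fun e =>
      hyb (hinj hy.left_mem h.right_mem (arc_right_injective _ e))
    have := hL.not_linked (sigma 3 a) (e := sigma 3 y) hab
      (by rw [Sym2.eq_swap]; exact hyz) (by simpa using hpos) hzb
    exact hynb' (le_antisymm this hynb)

lemma IsPrePolygon.image_sigma (hV : IsPrePolygon L V) (hL : IsInvariantLamination 3 L)
    (hinj : Set.InjOn (sigma 3) V) : IsPrePolygon L (sigma 3 '' V) where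
  finite := hV.finite.image _
  three a b := by
    obtain ⟨u, hu, -, -⟩ := hV.three a a
    obtain ⟨w, hw, hwu, -⟩ := hV.three u u
    obtain ⟨z, hz, hzu, hzw⟩ := hV.three u w
    by_contra! hall
    have h1 := hinj.ne hw hu hwu
    have h2 := hinj.ne hz hu hzu
    have h3 := hinj.ne hz hw hzw
    have k1 := hall _ ⟨u, hu, rfl⟩
    have k2 := hall _ ⟨w, hw, rfl⟩
    have k3 := hall _ ⟨z, hz, rfl⟩
    clear hall
    by_cases e1 : sigma 3 u = a <;> by_cases e2 : sigma 3 w = a <;> simp_all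
  leaf a b h := by
    obtain ⟨u, hu, rfl⟩ := h.left_mem
    obtain ⟨w, hw⟩ := hV.exists_next hu
    rw [h.right_unique (hV.cons_sigma hL hinj hw)]
    exact hL.leaf_sigma (hV.leaf _ _ hw) (hinj.ne hu hw.right_mem hw.ne)

/-! ### Polygons and leaves -/

/-- A polygon lies on one side of every leaf. -/
lemma IsPolygon.side (hV : IsPolygon L V) (hL : IsLamination L) {a b : Circle} (hab : a ≠ b)
    (h : s(a, b) ∈ L) : (∀ z ∈ V, arc a z ≤ arc a b) ∨ ∀ z ∈ V, arc b z ≤ arc b a := by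
  -- With vertices strictly on both sides, the side leaving the arc from its last inner vertex `u`
  -- can avoid crossing `a b` only by ending at `b`.
  have key : ∀ {a b : Circle}, a ≠ b → s(a, b) ∈ L → ∀ p ∈ V, ∀ q ∈ V, 0 < arc a p →
      arc a p < arc a b → arc a b < arc a q → b ∈ V := by
    intro a b hab h p hp q hq h0 h1 h2
    obtain ⟨u, ⟨hu, hu0, hu1⟩, hmax⟩ := Set.exists_max_image
      {z | z ∈ V ∧ 0 < arc a z ∧ arc a z < arc a b} (arc a)
      (hV.finite.subset fun z hz => hz.1) ⟨p, hp, h0, h1⟩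
    obtain ⟨w, hw⟩ := hV.exists_next hu
    have hqu : q ≠ u := by rintro rfl; linarith
    have e1 := hw.le q hq hqu
    have e2 : arc u q = arc a q - arc a u := arc_eq_sub (by linarith)
    have e3 : arc a u ≤ arc a w := by
      rcases arc_cases a u w with ⟨e3, -⟩ | ⟨e3, e4⟩
      · exact e3
      · linarith [arc_nonneg a w, arc_lt_one a q]
    have e4 : arc a u < arc a w := lt_of_le_of_ne e3 fun e => hw.ne (arc_right_injective _ e)
    have e5 : arc a b ≤ arc a w := by
      by_contra! hlt
      linarith [hmax w ⟨hw.right_mem, by linarith, hlt⟩]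
    have e6 := hL.not_linked a h (hV.leaf _ _ hw) (by simpa using hu0) hu1
    rw [arc_right_injective a (le_antisymm e5 e6)]
    exact hw.right_mem
  by_contra! hcon
  obtain ⟨⟨q, hq, hq1⟩, ⟨p, hp, hp1⟩⟩ := hcon
  have hsum := arc_add_arc hab
  have hqa : q ≠ a := by rintro rfl; linarith [arc_self q, arc_nonneg q b]
  have hpb : p ≠ b := by rintro rfl; linarith [arc_self p, arc_nonneg p a]
  have hp2 : 0 < arc a p ∧ arc a p < arc a b := by
    rw [arc_eq_sub_add_one (r := a) (by simpa using arc_pos hab), arc_self] at hp1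
    rcases arc_cases a b p with ⟨e1, e2⟩ | ⟨e1, e2⟩
    · linarith [arc_lt_one a p]
    · exact ⟨by linarith, e1⟩
  have hq2 : 0 < arc b q ∧ arc b q < arc b a := by
    rcases arc_cases a b q with ⟨e1, e2⟩ | ⟨e1, e2⟩
    · exact ⟨by linarith, by linarith [arc_lt_one a q]⟩
    · linarith
  have hb := key hab h p hp q hq hp2.1 hp2.2 hq1
  have ha := key hab.symm (by rwa [Sym2.eq_swap]) q hq p hp hq2.1 hq2.2 hp1
  rcases hV.diag a ha b hb hab h with hc | hc
  · have hpa : p ≠ a := ne_of_arc_pos hp2.1 |>.symm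
    linarith [hc.le p hp hpa]
  · have hqb : q ≠ b := ne_of_arc_pos hq2.1 |>.symm
    linarith [hc.le q hq hqb]

/-- Two polygons with a common oriented side are equal. -/
lemma IsPolygon.eq_of_cons {W : Set Circle} (hV : IsPolygon L V) (hW : IsPolygon L W)
    (hL : IsLamination L) {x y : Circle} (hVx : Cons V x y) (hWx : Cons W x y) : V = W := by
  have key : ∀ {V W : Set Circle}, IsPolygon L V → IsPolygon L W → Cons V x y → Cons W x y →
      W ⊆ V := by
    intro V W hV hW hVx hWx z hz
    by_contra hzV
    -- The side `a b` of `V` has `z` strictly behind it, so all of `W` lies behind it. The common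
    -- vertices `x`, `y` can then only be `a`, `b`, which puts `z` between consecutive points of
    -- `W`.
    obtain ⟨a, ha, hmin⟩ := Set.exists_min_image V (fun a => arc a z) hV.finite
      ⟨x, hVx.left_mem⟩
    obtain ⟨b, hb⟩ := hV.exists_next ha
    have hza : z ≠ a := fun e => hzV (e ▸ ha)
    have hzb : z ≠ b := fun e => hzV (e ▸ hb.right_mem)
    have hlt : arc a z < arc a b := by
      by_contra! hle
      have h1 := hmin b hb.right_mem
      simp only [arc_eq_sub hle] at h1
      linarith [arc_pos hb.ne]
    have hbz : arc b a < arc b z := by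
      have := arc_add_arc hb.ne
      rw [arc_eq_sub_add_one hlt]
      linarith [arc_pos hza.symm]
    rcases hW.side hL hb.ne (hV.leaf _ _ hb) with hs | hs
    · have hxa : x = a := by
        by_contra hne
        have h1 := hb.le x hVx.left_mem hne
        have h2 := arc_right_injective a (le_antisymm h1 (hs x hWx.left_mem))
        subst h2
        have hya : y ≠ a := by
          rintro rfl
          exact hV.not_cons_swap hVx hb
        have h3 := hb.le y hVx.right_mem hya
        exact hVx.ne (arc_right_injective a (le_antisymm h3 (hs y hWx.right_mem)))
      subst hxa
      have hby := hb.right_unique hVx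
      subst hby
      linarith [hWx.le z hz hza]
    · linarith [hs z hz]
  exact (key hW hV hWx hVx).antisymm (key hV hW hVx hWx)

/-! ### The maps `z ↦ ± σ₃ᵗ z` -/

/-- The map `z ↦ ε σ₃ᵗ z`. -/
def tau (ε : Circle) (t : ℕ) (z : Circle) : Circle := ε * (sigma 3)^[t] z

/-- `ε` is `1` or `-1`. -/
def IsSign (ε : Circle) : Prop := ε = 1 ∨ ε = -1

lemma IsSign.mul_self {ε : Circle} (h : IsSign ε) : ε * ε = 1 := by
  rcases h with rfl | rfl <;> simp

lemma IsSign.mul {ε ε' : Circle} (h : IsSign ε) (h' : IsSign ε') : IsSign (ε * ε') := by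
  rcases h with rfl | rfl <;> rcases h' with rfl | rfl <;> simp [IsSign]

lemma sigma_neg (z : Circle) : sigma 3 (-z) = -sigma 3 z :=
  Odd.neg_pow (by decide) z

lemma IsSign.iterate_mul {ε : Circle} (h : IsSign ε) (t : ℕ) (z : Circle) :
    (sigma 3)^[t] (ε * z) = ε * (sigma 3)^[t] z := by
  rcases h with rfl | rfl
  · simp
  · simp only [neg_one_mul]
    exact Function.Commute.iterate_left (g := fun z : Circle => -z) sigma_neg t z

lemma IsSign.tau_tau {ε ε' : Circle} (h' : IsSign ε') (t s : ℕ) (z : Circle) :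
    tau ε t (tau ε' s z) = tau (ε * ε') (t + s) z := by
  simp only [tau, h'.iterate_mul, Function.iterate_add_apply, mul_assoc]

lemma tau_one (t : ℕ) : tau 1 t = (sigma 3)^[t] := by
  ext z; simp [tau]

lemma iterate_mul_eq {z : Circle} (hz : (sigma 3)^[N] z = z) (k : ℕ) :
    (sigma 3)^[N * k] z = z := by
  rw [Function.iterate_mul]
  exact Function.iterate_fixed hz k

lemma iterate_fixed_iterate {z : Circle} (hz : (sigma 3)^[N] z = z) (t : ℕ) :
    (sigma 3)^[N] ((sigma 3)^[t] z) = (sigma 3)^[t] z := by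
  rw [← Function.iterate_add_apply, add_comm, Function.iterate_add_apply, hz]

/-- On points of period `N` the inverse of `σ₃ᵗ` is a further iterate, with exponent `N t - t`; a
sign is its own inverse and commutes with `σ₃` because 3 is odd. -/
lemma IsSign.exists_inverse {ε : Circle} (h : IsSign ε) (hN : 0 < N) (t : ℕ) :
    ∃ s, ∀ z, (sigma 3)^[N] z = z → tau ε s (tau ε t z) = z := by
  refine ⟨N * t - t, fun z hz => ?_⟩
  rw [h.tau_tau, h.mul_self, tau_one,
    Nat.sub_add_cancel (Nat.le_mul_of_pos_left t hN), iterate_mul_eq hz]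

lemma IsSign.tau_injOn {ε : Circle} (h : IsSign ε) (hN : 0 < N) (t : ℕ) :
    Set.InjOn (tau ε t) {z | (sigma 3)^[N] z = z} := by
  obtain ⟨s, hs⟩ := h.exists_inverse hN t
  intro x hx y hy e
  rw [← hs x hx, e, hs y hy]

lemma iterate_injOn (hN : 0 < N) (t : ℕ) :
    Set.InjOn (sigma 3)^[t] {z | (sigma 3)^[N] z = z} := by
  rw [← tau_one]; exact IsSign.tau_injOn (Or.inl rfl) hN t

lemma leaf_iterate (hL : IsInvariantLamination 3 L) (hN : 0 < N) {a b : Circle}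
    (ha : (sigma 3)^[N] a = a) (hb : (sigma 3)^[N] b = b) (hne : a ≠ b) (h : s(a, b) ∈ L)
    (t : ℕ) : s((sigma 3)^[t] a, (sigma 3)^[t] b) ∈ L := by
  induction t with
  | zero => exact h
  | succ t ih =>
    rw [Function.iterate_succ_apply', Function.iterate_succ_apply']
    refine hL.leaf_sigma ih fun e => hne ?_
    rw [← Function.iterate_succ_apply' (sigma 3), ← Function.iterate_succ_apply' (sigma 3)] at e
    exact iterate_injOn hN (t + 1) ha hb e

lemma IsPrePolygon.iterate (hV : IsPrePolygon L V) (hL : IsInvariantLamination 3 L) (hN : 0 < N)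
    (hfix : ∀ z ∈ V, (sigma 3)^[N] z = z) (t : ℕ) :
    IsPrePolygon L ((sigma 3)^[t] '' V) ∧
      ∀ a b, Cons V a b → Cons ((sigma 3)^[t] '' V) ((sigma 3)^[t] a) ((sigma 3)^[t] b) := by
  induction t with
  | zero => simpa using hV
  | succ t ih =>
    have hinj : Set.InjOn (sigma 3) ((sigma 3)^[t] '' V) := by
      refine (iterate_injOn hN 1).mono ?_
      rintro _ ⟨z, hz, rfl⟩
      exact iterate_fixed_iterate (hfix z hz) t
    rw [Function.iterate_succ', Set.image_comp]
    exact ⟨ih.1.image_sigma hL hinj, fun a b h => ih.1.cons_sigma hL hinj (ih.2 a b h)⟩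

lemma Cons.mul_left {a b : Circle} (h : Cons V a b) (ε : Circle) :
    Cons ((ε * ·) '' V) (ε * a) (ε * b) := by
  refine ⟨⟨a, h.left_mem, rfl⟩, ⟨b, h.right_mem, rfl⟩, fun e => h.ne (mul_left_cancel e), ?_⟩
  rintro _ ⟨c, hc, rfl⟩ hca
  simpa using h.le c hc fun e => hca (by rw [e])

lemma IsSymmetricLamination.leaf_mul (hL : IsSymmetricLamination L) {ε : Circle} (hε : IsSign ε)
    {a b : Circle} (h : s(a, b) ∈ L) : s(ε * a, ε * b) ∈ L := by
  rcases hε with rfl | rfl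
  · simpa using h
  · simpa [negChord] using hL.symm _ h

lemma tau_image (ε : Circle) (t : ℕ) (V : Set Circle) :
    tau ε t '' V = (ε * ·) '' ((sigma 3)^[t] '' V) := by
  rw [Set.image_image]; rfl

lemma IsPrePolygon.cons_tau (hV : IsPrePolygon L V) (hL : IsInvariantLamination 3 L) (hN : 0 < N)
    (hfix : ∀ z ∈ V, (sigma 3)^[N] z = z) (ε : Circle) (t : ℕ) {a b : Circle}
    (h : Cons V a b) : Cons (tau ε t '' V) (tau ε t a) (tau ε t b) := by
  rw [tau_image]
  exact ((hV.iterate hL hN hfix t).2 a b h).mul_left ε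

lemma IsPolygon.image_tau (hV : IsPolygon L V) (hL : IsSymmetricLamination L) (hN : 0 < N)
    (hfix : ∀ z ∈ V, (sigma 3)^[N] z = z) {ε : Circle} (hε : IsSign ε) (t : ℕ) :
    IsPolygon L (tau ε t '' V) where
  finite := hV.finite.image _
  three a b := by
    obtain ⟨c, hc, hca, hcb⟩ :=
      (hV.iterate hL.toIsInvariantLamination hN hfix t).1.three (ε * a) (ε * b)
    refine ⟨ε * c, by rw [tau_image]; exact ⟨c, hc, rfl⟩, fun e => hca ?_, fun e => hcb ?_⟩ <;>
      rw [← e, ← mul_assoc, hε.mul_self, one_mul]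
  leaf a b h := by
    obtain ⟨u, hu, rfl⟩ := h.left_mem
    obtain ⟨w, hw⟩ := hV.exists_next hu
    rw [h.right_unique (hV.cons_tau hL.toIsInvariantLamination hN hfix ε t hw)]
    exact hL.leaf_mul hε (leaf_iterate hL.toIsInvariantLamination hN (hfix _ hu)
      (hfix _ hw.right_mem) hw.ne (hV.leaf _ _ hw) t)
  diag := by
    rintro _ ⟨a, ha, rfl⟩ _ ⟨b, hb, rfl⟩ hne h
    have h1 := hL.leaf_mul hε h
    simp only [tau, ← mul_assoc, hε.mul_self, one_mul] at h1
    have hab : a ≠ b := by rintro rfl; exact hne rfl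
    -- A leaf between image vertices is pushed forward until it returns to `V`, where `diag`
    -- applies.
    have h2 := leaf_iterate hL.toIsInvariantLamination hN (iterate_fixed_iterate (hfix a ha) t)
      (iterate_fixed_iterate (hfix b hb) t)
      (fun e => hne (by simp only [tau, e])) h1 (N * t - t)
    rw [← Function.iterate_add_apply, ← Function.iterate_add_apply,
      Nat.sub_add_cancel (Nat.le_mul_of_pos_left t hN), iterate_mul_eq (hfix a ha),
      iterate_mul_eq (hfix b hb)] at h2
    exact (hV.diag a ha b hb hab h2).imp
      (hV.cons_tau hL.toIsInvariantLamination hN hfix ε t)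
      (hV.cons_tau hL.toIsInvariantLamination hN hfix ε t)

/-! ### Lengths of chords -/

/-- The length of a chord: the length of the shorter of the two arcs cut off by it. -/
def len (a b : Circle) : ℝ := min (arc a b) (arc b a)

lemma len_comm (a b : Circle) : len a b = len b a := min_comm _ _

lemma len_eq_arc {a b : Circle} (h : arc a b ≤ 1 / 2) : len a b = arc a b := by
  rcases eq_or_ne a b with rfl | hne
  · simp [len]
  · exact min_eq_left (by linarith [arc_add_arc hne])

lemma arc_le_half_or {a b : Circle} (h : a ≠ b) : arc a b ≤ 1 / 2 ∨ arc b a ≤ 1 / 2 := by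
  by_contra! hcon
  linarith [arc_add_arc h, hcon.1, hcon.2]

/-- Here `3 * arc a b` is within `1/2` of `1`, so its distance to `1` is the length of the image. -/
lemma len_sigma {a b : Circle} (h : 1 / 6 ≤ arc a b) (h' : arc a b ≤ 1 / 2) :
    len (sigma 3 a) (sigma 3 b) = 3 * |arc a b - 1 / 3| := by
  have e := arc_sigma a b
  rcases lt_or_ge (arc a b) (1 / 3) with h1 | h1
  · rw [Int.fract_eq_self.2 ⟨by linarith, by linarith⟩] at e
    have hne : sigma 3 a ≠ sigma 3 b := ne_of_arc_pos (by rw [e]; linarith)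
    have := arc_add_arc hne
    rw [abs_of_neg (by linarith), len_comm, len_eq_arc] <;> linarith
  · rw [← Int.fract_sub_one, Int.fract_eq_self.2 ⟨by linarith, by linarith⟩] at e
    rw [abs_of_nonneg (by linarith), len_eq_arc] <;> linarith

/-- A side of minimal length in its orbit is the image of a chord of length more than `1/6`. -/
lemma one_sixth_lt {a b : Circle} (hne : a ≠ b) (h : arc a b ≤ 1 / 2)
    (hlen : len (sigma 3 a) (sigma 3 b) ≤ len a b) : 1 / 6 < arc a b := by
  by_contra! hle
  have e := arc_sigma a b
  have h0 := arc_pos hne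
  rw [Int.fract_eq_self.2 ⟨by linarith, by linarith⟩] at e
  rw [len_eq_arc h, len_eq_arc (by linarith)] at hlen
  linarith

/-- In a polygon that lies over an arc of length `s ≤ 1/2`, only the side facing the
complementary arc can have length at least `s`. -/
lemma IsPrePolygon.half_le_arc (hV : IsPrePolygon L V) {r : Circle} {s : ℝ} (hs : s ≤ 1 / 2)
    (hr : ∀ z ∈ V, arc r z ≤ s) {c d : Circle} (h : Cons V c d) (hlen : s ≤ len c d) :
    1 / 2 ≤ arc c d := by
  have h1 : s ≤ arc c d := hlen.trans (min_le_left _ _)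
  have hc := hr c h.left_mem
  have hd := hr d h.right_mem
  rcases arc_cases r c d with ⟨e1, e2⟩ | ⟨e1, e2⟩
  · exfalso
    have hc0 : arc r c = 0 := by linarith [arc_nonneg r c]
    obtain rfl := arc_eq_zero.1 hc0
    obtain ⟨z, hz, hzc, hzd⟩ := hV.three r d
    exact hzd (arc_right_injective r (by linarith [hr z hz, h.le z hz hzc]))
  · have h2 := hs
    linarith [arc_nonneg r d]

/-- Two disjoint complementary arcs of length at least `1/2` would fill the circle and leave room
for only two vertices. -/
lemma IsPrePolygon.eq_of_half_le (hV : IsPrePolygon L V) {a b c d : Circle} (h : Cons V a b)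
    (h' : Cons V c d) (h1 : 1 / 2 ≤ arc a b) (h2 : 1 / 2 ≤ arc c d) : a = c := by
  by_contra hne
  have e1 := h.le c h'.left_mem (Ne.symm hne)
  have e2 := h'.le a h.left_mem hne
  have e3 := arc_add_arc hne
  have hb : b = c := arc_right_injective a (by linarith)
  have hd : d = a := arc_right_injective c (by linarith)
  subst hb hd
  exact hV.not_cons_swap h h'

/-- The polygon lies over the short arc cut off by the side `a b`, and a third vertex subdivides
that arc. -/
lemma IsPrePolygon.exists_shorter (hV : IsPrePolygon L V) {a b : Circle} (h : Cons V a b)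
    (hba : arc b a ≤ 1 / 2) : ∃ c d, Cons V c d ∧ len c d < len a b := by
  obtain ⟨c, hc⟩ := hV.exists_next h.right_mem
  refine ⟨b, c, hc, ?_⟩
  rw [len_comm a b, len_eq_arc hba]
  by_contra! hle
  have hr : ∀ z ∈ V, arc b z ≤ arc b a := by
    intro z hz
    rcases eq_or_ne z b with rfl | hzb
    · simpa using arc_nonneg _ _
    rcases arc_cases a b z with ⟨e1, e2⟩ | ⟨e1, e2⟩
    · have := arc_add_arc h.ne
      linarith [arc_lt_one a z]
    · rcases eq_or_ne z a with rfl | hza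
      · rfl
      · linarith [h.le z hz hza]
  have h1 := hV.half_le_arc hba hr hc hle
  have h2 := hr c hc.right_mem
  have h3 : c = a := arc_right_injective b (by linarith [hc.le a h.left_mem h.ne])
  subst h3
  exact hV.not_cons_swap h hc

/-! ### Critical strips -/

lemma IsLamination.arc_between (hL : IsLamination L) (r : Circle) {a b c e : Circle}
    (hab : s(a, b) ∈ L) (hce : s(c, e) ∈ L) (h1 : arc r a < arc r c) (h2 : arc r c < arc r b) :
    arc r a ≤ arc r e ∧ arc r e ≤ arc r b := by
  refine ⟨?_, hL.not_linked r hab hce h1 h2⟩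
  by_contra! h3
  have := hL.not_linked r (a := e) (b := c) (c := a) (e := b) (by rwa [Sym2.eq_swap]) hab h3 h1
  linarith

/-- Both endpoints of a leaf lie on the same side of another one. -/
lemma IsLamination.leaf_side (hL : IsLamination L) {a b c e : Circle} (hne : a ≠ b)
    (hab : s(a, b) ∈ L) (hce : s(c, e) ∈ L) : (arc a c ≤ arc a b ∧ arc a e ≤ arc a b) ∨
      (arc b c ≤ arc b a ∧ arc b e ≤ arc b a) := by
  have hsum := arc_add_arc hne
  have conv : ∀ z, arc a b ≤ arc a z → arc b z ≤ arc b a := fun z hz => by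
    rw [arc_eq_sub hz]; linarith [arc_lt_one a z]
  have key : ∀ {c e : Circle}, s(c, e) ∈ L → arc a c ≤ arc a b → arc a b < arc a e →
      arc b c ≤ arc b a := by
    intro c e hce h1 h2
    rcases eq_or_ne c a with rfl | hca
    · rfl
    rcases h1.lt_or_eq with h1 | h1
    · linarith [(hL.arc_between a hab hce (by simpa using arc_pos hca.symm) h1).2]
    · exact conv c h1.ge
  rcases le_or_gt (arc a c) (arc a b) with h1 | h1 <;>
    rcases le_or_gt (arc a e) (arc a b) with h2 | h2
  · exact Or.inl ⟨h1, h2⟩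
  · exact Or.inr ⟨key hce h1 h2, conv e h2.le⟩
  · exact Or.inr ⟨conv c h1.le, key (by rwa [Sym2.eq_swap]) h2 h1⟩
  · exact Or.inr ⟨conv c h1.le, conv e h2.le⟩

lemma exists_fin_three_eq {j : Fin 3 → ℤ} (h0 : ∀ i, 0 ≤ j i) (h2 : ∀ i, j i ≤ 2)
    (hinj : ∀ i i', i ≠ i' → j i ≠ j i') {c : ℤ} (hc0 : 0 ≤ c) (hc2 : c ≤ 2) :
    ∃ i, j i = c := by
  by_contra! hne
  have := hinj 0 1 (by decide)
  have := hinj 0 2 (by decide)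
  have := hinj 1 2 (by decide)
  have := hne 0
  have := hne 1
  have := hne 2
  have := h0 0
  have := h0 1
  have := h0 2
  have := h2 0
  have := h2 1
  have := h2 2
  omega

/-- The siblings of a leaf in the coordinate with base point `p`. -/
lemma IsInvariantLamination.exists_sibling_positions (hL : IsInvariantLamination 3 L)
    {a b : Circle} (hab : s(a, b) ∈ L) (hne : sigma 3 a ≠ sigma 3 b) (p : Circle) {α β : ℝ}
    (hα : arc (sigma 3 p) (sigma 3 a) = α) (hβ : arc (sigma 3 p) (sigma 3 b) = β) :
    ∃ (x y : Fin 3 → Circle) (j k : Fin 3 → ℤ) (i₀ : Fin 3), x i₀ = a ∧ y i₀ = b ∧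
      (∀ i, s(x i, y i) ∈ L) ∧ (∀ i, 3 * arc p (x i) = α + j i) ∧
      (∀ i, 3 * arc p (y i) = β + k i) ∧ (∀ i, 0 ≤ j i) ∧ (∀ i, j i ≤ 2) ∧ (∀ i, 0 ≤ k i) ∧
      (∀ i, k i ≤ 2) ∧ (∀ i i', i ≠ i' → j i ≠ j i') ∧ ∀ i i', i ≠ i' → k i ≠ k i' := by
  obtain ⟨x, y, i₀, hx₀, hy₀, hxy, hd⟩ := hL.exists_siblings hab hne
  have hj : ∀ i, ∃ j : ℤ, 3 * arc p (x i) = α + j ∧ 0 ≤ j ∧ j ≤ 2 :=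
    fun i => exists_int_of_arc_sigma (by rw [(hxy i).2.1, hα])
  have hk : ∀ i, ∃ k : ℤ, 3 * arc p (y i) = β + k ∧ 0 ≤ k ∧ k ≤ 2 :=
    fun i => exists_int_of_arc_sigma (by rw [(hxy i).2.2, hβ])
  choose j hj hj0 hj2 using hj
  choose k hk hk0 hk2 using hk
  refine ⟨x, y, j, k, i₀, hx₀, hy₀, fun i => (hxy i).1, hj, hk, hj0, hj2, hk0, hk2,
    fun i i' hi e => ?_, fun i i' hi e => ?_⟩
  · refine not_disjoint_chord (Or.inl (arc_right_injective p ?_)) (hd i i' hi)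
    have h1 := hj i
    rw [e] at h1
    linarith [hj i']
  · refine not_disjoint_chord (Or.inr (Or.inr (Or.inr (arc_right_injective p ?_)))) (hd i i' hi)
    have h1 := hk i
    rw [e] at h1
    linarith [hk i']

/-- A leaf of length different from `1/3` gives rise to the two leaves that bound a strip around
a critical chord. -/
lemma IsSymmetricLamination.exists_strip (hL : IsSymmetricLamination L) {a b : Circle}
    (hab : s(a, b) ∈ L) (hne : sigma 3 a ≠ sigma 3 b) (h1 : 1 / 6 < arc a b)
    (h2 : arc a b < 1 / 2) : ∃ p δ, δ = |arc a b - 1 / 3| ∧ 0 < δ ∧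
      s(p, p * turn (1 / 3 + δ)) ∈ L ∧ s(p * turn δ, p * turn (1 / 3)) ∈ L ∧
      s(sigma 3 a, sigma 3 b) = s(sigma 3 p, sigma 3 p * turn (3 * δ)) := by
  have hone : turn (3 * (1 / 3)) = 1 := by
    have := turn_int 1
    norm_num at this ⊢
    exact this
  have h13 : arc a b ≠ 1 / 3 := by
    intro h
    apply hne
    rw [← mul_turn_arc a b, sigma_mul_turn, h, hone, mul_one]
  rcases lt_or_gt_of_ne h13 with hlt | hgt
  -- The given leaf is the inner edge of the strip, at coordinates `δ` and `1/3` from `p`.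
  · set p := b * turn (-(1 / 3)) with hp
    have hbp : b = p * turn (1 / 3) := by
      rw [hp, mul_assoc, ← turn_add]; simp
    have hap : a = p * turn (1 / 3 - arc a b) := by
      rw [hp, mul_assoc, ← turn_add, show -(1 / 3) + (1 / 3 - arc a b) = -arc a b by ring]
      conv_rhs => rw [← mul_turn_arc a b, mul_assoc, ← turn_add, arc_mul_turn_of_lt _
        (arc_nonneg _ _) (arc_lt_one _ _), add_neg_cancel, turn_zero, mul_one]
    set δ := 1 / 3 - arc a b with hδ
    have hδ0 : 0 < δ := by linarith
    have hσb : sigma 3 b = sigma 3 p := by rw [hbp, sigma_mul_turn, hone, mul_one]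
    have hσa : sigma 3 a = sigma 3 p * turn (3 * δ) := by rw [hap, sigma_mul_turn]
    have hpa : arc p a = δ := by rw [hap]; exact arc_mul_turn_of_lt _ hδ0.le (by linarith)
    have hpb : arc p b = 1 / 3 := by
      rw [hbp]; exact arc_mul_turn_of_lt _ (by norm_num) (by norm_num)
    refine ⟨p, δ, by rw [abs_of_neg (by linarith)]; ring, hδ0, ?_,
      by rw [← hap, ← hbp]; exact hab, by rw [hσb, hσa, Sym2.eq_swap]⟩
    have hna : arc p (-a) = δ + 1 / 2 := by
      rw [neg_eq_mul_turn, hap, mul_assoc, ← turn_add]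
      exact arc_mul_turn_of_lt _ (by linarith) (by linarith)
    have hnb : arc p (-b) = 1 / 3 + 1 / 2 := by
      rw [neg_eq_mul_turn, hbp, mul_assoc, ← turn_add]
      exact arc_mul_turn_of_lt _ (by linarith) (by linarith)
    obtain ⟨x, y, j, k, i₀, hx₀, hy₀, hxy, hj, hk, hj0, hj2, hk0, hk2, hji, hki⟩ :=
      hL.exists_sibling_positions hab hne p (α := 3 * δ) (β := 0)
        (by rw [hσa]; exact arc_mul_turn_of_lt _ (by linarith) (by linarith))
        (by rw [hσb, arc_self])
    obtain ⟨i, hi⟩ := exists_fin_three_eq hk0 hk2 hki le_rfl (by norm_num)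
    have hyi : arc p (y i) = 0 := by
      have := hk i
      rw [hi] at this
      push_cast at this
      linarith
    have hii₀ : i ≠ i₀ := by
      rintro rfl
      rw [hy₀] at hyi
      linarith
    have hj₀ : j i₀ = 0 := by
      have := hj i₀
      rw [hx₀, hpa] at this
      exact_mod_cast (by linarith : (j i₀ : ℝ) = 0)
    -- The sibling ending at `p` starts at `1/3 + δ` or `2/3 + δ`. The latter lies strictly under
    -- the leaf `-a, -b`, which spans `1/2 + δ` to `5/6`, so symmetry of the lamination excludes it.
    have hj1 : j i = 1 := by
      have e1 := hji i i₀ hii₀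
      have e2 := hj0 i
      have e3 := hj2 i
      by_contra hne1
      have hj2 : j i = 2 := by omega
      have e4 := hj i
      rw [hj2] at e4
      push_cast at e4
      have hneg : s(-a, -b) ∈ L := by simpa using hL.leaf_mul (Or.inr rfl) hab
      have e5 := (hL.arc_between p hneg (hxy i) (by rw [hna]; linarith)
        (by rw [hnb]; linarith)).1
      rw [hna, hyi] at e5
      linarith
    have hxi : arc p (x i) = 1 / 3 + δ := by
      have := hj i
      rw [hj1] at this
      push_cast at this
      linarith
    have := hxy i
    rwa [← mul_turn_arc p (x i), hxi, ← arc_eq_zero.1 hyi, Sym2.eq_swap] at this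
  -- The given leaf is now the outer edge; the sibling from `1/3` has to stay under it, which leaves
  -- only `δ` as its other end.
  · set δ := arc a b - 1 / 3 with hδ
    have hδ0 : 0 < δ := by linarith
    have hba : b = a * turn (1 / 3 + δ) := by
      rw [hδ, add_sub_cancel, mul_turn_arc]
    have hσb : sigma 3 b = sigma 3 a * turn (3 * δ) := by
      rw [hba, sigma_mul_turn, mul_add, turn_add, hone, one_mul]
    refine ⟨a, δ, (abs_of_pos hδ0).symm, hδ0, by rw [← hba]; exact hab, ?_, by rw [hσb]⟩
    obtain ⟨x, y, j, k, i₀, hx₀, hy₀, hxy, hj, hk, hj0, hj2, hk0, hk2, hji, hki⟩ :=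
      hL.exists_sibling_positions hab hne a (α := 0) (β := 3 * δ) (arc_self _)
        (by rw [hσb]; exact arc_mul_turn_of_lt _ (by linarith) (by linarith))
    obtain ⟨i, hi⟩ := exists_fin_three_eq hj0 hj2 hji (c := 1) (by norm_num) (by norm_num)
    have hxi : arc a (x i) = 1 / 3 := by
      have := hj i
      rw [hi] at this
      push_cast at this
      linarith
    have hii₀ : i ≠ i₀ := by
      rintro rfl
      rw [hx₀, arc_self] at hxi
      linarith
    have hk₀ : k i₀ = 1 := by
      have := hk i₀
      rw [hy₀] at this
      exact_mod_cast (by linarith : (k i₀ : ℝ) = 1)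
    have hle := (hL.arc_between a hab (hxy i) (by rw [arc_self]; linarith) (by linarith)).2
    have hk1 : k i < 2 := by
      have e := hk i
      exact_mod_cast (by linarith : (k i : ℝ) < 2)
    have hk' : k i = 0 := by
      have := hki i i₀ hii₀
      have := hk0 i
      omega
    have hyi : arc a (y i) = δ := by
      have := hk i
      rw [hk'] at this
      push_cast at this
      linarith
    have := hxy i
    rwa [← mul_turn_arc a (x i), ← mul_turn_arc a (y i), hxi, hyi, Sym2.eq_swap] at this

/-- Here `u`, `w` are the coordinates of the endpoints of a leaf. A leaf with an endpoint strictly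
inside an inner arc is confined to it, and its arc is then too short or too long. The two arcs
outside the strips have length `1/6 - δ`: a chord within one is too short, and one joining the two
is too long in either direction. The four boundary leaves forbid everything else except the end arcs
of a single strip. -/
lemma strip_positions {δ u w x : ℝ} (hδ : 0 < δ) (hδ' : δ < 1 / 6) (hu' : u < 1)
    (hw : 0 ≤ w) (hw' : w < 1) (hx : 1 / 3 - δ ≤ x) (hx' : x ≤ 1 / 3 + δ)
    (hux : (u ≤ w ∧ x = w - u) ∨ (w < u ∧ x = w - u + 1))
    (h1 : 0 < u → u < 1 / 3 + δ → w ≤ 1 / 3 + δ)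
    (h1' : 0 < w → w < 1 / 3 + δ → u ≤ 1 / 3 + δ)
    (h2 : δ < u → u < 1 / 3 → δ ≤ w ∧ w ≤ 1 / 3)
    (h2' : δ < w → w < 1 / 3 → δ ≤ u ∧ u ≤ 1 / 3)
    (h3 : 1 / 2 < u → u < 5 / 6 + δ → 1 / 2 ≤ w ∧ w ≤ 5 / 6 + δ)
    (h3' : 1 / 2 < w → w < 5 / 6 + δ → 1 / 2 ≤ u ∧ u ≤ 5 / 6 + δ)
    (h4 : 1 / 2 + δ < u → u < 5 / 6 → 1 / 2 + δ ≤ w ∧ w ≤ 5 / 6)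
    (h4' : 1 / 2 + δ < w → w < 5 / 6 → 1 / 2 + δ ≤ u ∧ u ≤ 5 / 6) :
    (u ≤ 1 / 2 ∧ w ≤ 1 / 2 ∧ (u ≤ δ ∨ 1 / 3 ≤ u ∧ u ≤ 1 / 3 + δ) ∧
      (w ≤ δ ∨ 1 / 3 ≤ w ∧ w ≤ 1 / 3 + δ)) ∨
    (1 / 2 ≤ u ∧ 1 / 2 ≤ w ∧ (u ≤ 1 / 2 + δ ∨ 5 / 6 ≤ u ∧ u ≤ 5 / 6 + δ) ∧
      (w ≤ 1 / 2 + δ ∨ 5 / 6 ≤ w ∧ w ≤ 5 / 6 + δ)) := by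
  have a1 : ¬ (δ < u ∧ u < 1 / 3) := fun h => by
    have := h2 h.1 h.2; rcases hux with h5 | h5 <;> linarith
  have a2 : ¬ (δ < w ∧ w < 1 / 3) := fun h => by
    have := h2' h.1 h.2; rcases hux with h5 | h5 <;> linarith
  have a3 : ¬ (1 / 2 + δ < u ∧ u < 5 / 6) := fun h => by
    have := h4 h.1 h.2; rcases hux with h5 | h5 <;> linarith
  have a4 : ¬ (1 / 2 + δ < w ∧ w < 5 / 6) := fun h => by
    have := h4' h.1 h.2; rcases hux with h5 | h5 <;> linarith
  clear h2 h2' h4 h4'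
  grind (splits := 25)

/-- A leaf whose length is as close to `1/3` as the boundary leaves of a strip lies in that strip
or in the opposite one. -/
lemma IsSymmetricLamination.arc_sigma_le_of_strip (hL : IsSymmetricLamination L) {p c e : Circle}
    {δ : ℝ} (hδ : 0 < δ) (hδ' : δ < 1 / 6) (h₁ : s(p, p * turn (1 / 3 + δ)) ∈ L)
    (h₂ : s(p * turn δ, p * turn (1 / 3)) ∈ L) (hce : s(c, e) ∈ L)
    (hx : |arc c e - 1 / 3| ≤ δ) : ∃ η, IsSign η ∧
      arc (η * sigma 3 p) (sigma 3 c) ≤ 3 * δ ∧ arc (η * sigma 3 p) (sigma 3 e) ≤ 3 * δ := by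
  have h₃ := hL.leaf_mul (Or.inr rfl) h₁
  have h₄ := hL.leaf_mul (Or.inr rfl) h₂
  simp only [neg_one_mul, neg_eq_mul_turn (p * _), mul_assoc, ← turn_add,
    neg_eq_mul_turn p] at h₃ h₄
  have hp : ∀ t : ℝ, 0 ≤ t → t < 1 → arc p (p * turn t) = t :=
    fun t h0 h1 => arc_mul_turn_of_lt p h0 h1
  have hp1 := hp (1 / 3 + δ) (by linarith) (by linarith)
  have hp2 := hp δ (by linarith) (by linarith)
  have hp3 := hp (1 / 3) (by linarith) (by linarith)
  have hp4 := hp (1 / 2) (by linarith) (by linarith)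
  have hp5 := hp (1 / 3 + δ + 1 / 2) (by linarith) (by linarith)
  have hp6 := hp (δ + 1 / 2) (by linarith) (by linarith)
  have hp7 := hp (1 / 3 + 1 / 2) (by linarith) (by linarith)
  have hec : s(e, c) ∈ L := by rwa [Sym2.eq_swap]
  have hbetween : ∀ {c e : Circle}, s(c, e) ∈ L →
      (0 < arc p c → arc p c < 1 / 3 + δ → arc p e ≤ 1 / 3 + δ) ∧
      (δ < arc p c → arc p c < 1 / 3 → δ ≤ arc p e ∧ arc p e ≤ 1 / 3) ∧
      (1 / 2 < arc p c → arc p c < 5 / 6 + δ → 1 / 2 ≤ arc p e ∧ arc p e ≤ 5 / 6 + δ) ∧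
      (1 / 2 + δ < arc p c → arc p c < 5 / 6 → 1 / 2 + δ ≤ arc p e ∧ arc p e ≤ 5 / 6) := by
    intro c e hce
    refine ⟨fun u v => ?_, fun u v => ?_, fun u v => ?_, fun u v => ?_⟩
    · have := hL.arc_between p h₁ hce (by rw [arc_self]; exact u) (by rw [hp1]; exact v)
      rw [hp1] at this
      exact this.2
    · have := hL.arc_between p h₂ hce (by rw [hp2]; exact u) (by rw [hp3]; exact v)
      rwa [hp2, hp3] at this
    · have := hL.arc_between p h₃ hce (by rw [hp4]; exact u) (by rw [hp5]; linarith)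
      rw [hp4, hp5] at this
      exact ⟨this.1, by linarith [this.2]⟩
    · have := hL.arc_between p h₄ hce (by rw [hp6]; linarith) (by rw [hp7]; linarith)
      rw [hp6, hp7] at this
      exact ⟨by linarith [this.1], by linarith [this.2]⟩
  obtain ⟨b1, b2, b3, b4⟩ := hbetween hce
  obtain ⟨c1, c2, c3, c4⟩ := hbetween hec
  rw [abs_le] at hx
  have hpos := strip_positions hδ hδ' (arc_lt_one p c) (arc_nonneg p e)
    (arc_lt_one p e) (by linarith [hx.1]) (by linarith [hx.2]) (arc_cases p c e) b1 c1 b2 c2 b3 c3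
    b4 c4
  -- The two end arcs of a strip differ by a third of a turn, so they have the same image, of length
  -- `3 * δ`.
  have near : ∀ q z : Circle, (arc q z ≤ δ ∨ 1 / 3 ≤ arc q z ∧ arc q z ≤ 1 / 3 + δ) →
      arc (sigma 3 q) (sigma 3 z) ≤ 3 * δ := by
    intro q z hz
    have h0 := arc_nonneg q z
    rw [arc_sigma]
    rcases hz with hz | hz
    · rw [Int.fract_eq_self.2 ⟨by linarith, by linarith⟩]; linarith
    · rw [← Int.fract_sub_one, Int.fract_eq_self.2 ⟨by linarith [hz.1], by linarith [hz.2]⟩]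
      linarith [hz.2]
  rcases hpos with ⟨-, -, hc, he⟩ | ⟨hc, he, hc', he'⟩
  · exact ⟨1, Or.inl rfl, by rw [one_mul]; exact near p c hc, by rw [one_mul]; exact near p e he⟩
  · have hp8 : arc p (-p) = 1 / 2 := by rw [neg_eq_mul_turn, hp4]
    have shift : ∀ z, 1 / 2 ≤ arc p z → arc (-p) z = arc p z - 1 / 2 := fun z hz => by
      rw [arc_eq_sub (r := p) (by rw [hp8]; exact hz), hp8]
    refine ⟨-1, Or.inr rfl, ?_, ?_⟩ <;> rw [neg_one_mul, ← sigma_neg] <;> refine near _ _ ?_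
    · rw [shift c hc]
      exact hc'.imp (fun h => by linarith) fun h => ⟨by linarith [h.1], by linarith [h.2]⟩
    · rw [shift e he]
      exact he'.imp (fun h => by linarith) fun h => ⟨by linarith [h.1], by linarith [h.2]⟩

/-- Of two leaves of length more than `1/6`, the one closer to `1/3` has its image under the image
of the other one, up to a rotation by 180 degrees. -/
lemma IsSymmetricLamination.exists_nested (hL : IsSymmetricLamination L) {a b c e : Circle}
    (hab : s(a, b) ∈ L) (hne : sigma 3 a ≠ sigma 3 b) (h1 : 1 / 6 < arc a b)
    (h2 : arc a b ≤ 1 / 2) (hce : s(c, e) ∈ L) (hne' : sigma 3 c ≠ sigma 3 e)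
    (hle : |arc c e - 1 / 3| ≤ |arc a b - 1 / 3|) :
    ∃ η r r', IsSign η ∧ s(r, r') = s(η * sigma 3 a, η * sigma 3 b) ∧
      arc r r' = 3 * |arc a b - 1 / 3| ∧ arc r (sigma 3 c) ≤ arc r r' ∧
      arc r (sigma 3 e) ≤ arc r r' := by
  rcases h2.lt_or_eq with h2 | h2
  · obtain ⟨p, δ, hδ, hδ0, hl1, hl2, himg⟩ := hL.exists_strip hab hne h1 h2
    have hδ' : δ < 1 / 6 := by rw [hδ, abs_lt]; constructor <;> linarith
    obtain ⟨η, hη, hc, he⟩ := hL.arc_sigma_le_of_strip hδ0 hδ' hl1 hl2 hce (hδ ▸ hle)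
    have harc : arc (η * sigma 3 p) (η * sigma 3 p * turn (3 * δ)) = 3 * δ :=
      arc_mul_turn_of_lt _ (by linarith) (by linarith)
    refine ⟨η, η * sigma 3 p, η * sigma 3 p * turn (3 * δ), hη, ?_, by rw [harc, hδ],
      by rwa [harc], by rwa [harc]⟩
    have := congrArg (Sym2.map (η * ·)) himg
    simp only [Sym2.map_mk] at this
    rw [this, mul_assoc]
  -- A diameter has a diameter as image; both of its sides have length `1/2`, so either side may
  -- contain the other image.
  · have harc : arc (sigma 3 a) (sigma 3 b) = 1 / 2 := by
      rw [arc_sigma, h2, ← Int.fract_sub_one, Int.fract_eq_self.2 ⟨by norm_num, by norm_num⟩]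
      norm_num
    have harc' : arc (sigma 3 b) (sigma 3 a) = 1 / 2 := by linarith [arc_add_arc hne]
    have habs : 3 * |arc a b - 1 / 3| = 1 / 2 := by
      rw [h2, abs_of_pos (by norm_num)]; norm_num
    rcases hL.leaf_side hne (hL.leaf_sigma hab hne) (hL.leaf_sigma hce hne') with h | h
    · exact ⟨1, sigma 3 a, sigma 3 b, Or.inl rfl, by simp, by rw [harc, habs], h.1, h.2⟩
    · exact ⟨1, sigma 3 b, sigma 3 a, Or.inl rfl, by simp [Sym2.eq_swap], by rw [harc', habs],
        h.1, h.2⟩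

/-! ### Transitivity on the vertices of a periodic polygon -/

/-- `v` is the image of `u` under a map `ε σ₃ᵗ` that preserves `V`. -/
def SignEquivalent (V : Set Circle) (ε u v : Circle) : Prop :=
  ∃ t, tau ε t '' V = V ∧ tau ε t u = v

/-- `v` is the image of `u` under a map `± σ₃ᵗ` that preserves `V`. -/
def Equivalent (V : Set Circle) (u v : Circle) : Prop :=
  ∃ ε, IsSign ε ∧ SignEquivalent V ε u v

lemma IsSign.exists_inverse_image {ε : Circle} (hε : IsSign ε) (hN : 0 < N)
    (hfix : ∀ z ∈ V, (sigma 3)^[N] z = z) (t : ℕ) :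
    ∃ s, tau ε s '' (tau ε t '' V) = V ∧ ∀ z ∈ V, tau ε s (tau ε t z) = z := by
  obtain ⟨s, hs⟩ := hε.exists_inverse hN t
  refine ⟨s, ?_, fun z hz => hs z (hfix z hz)⟩
  rw [Set.image_image]
  exact (Set.image_congr fun z hz => hs z (hfix z hz)).trans (Set.image_id V)

lemma SignEquivalent.symm (hN : 0 < N) (hfix : ∀ z ∈ V, (sigma 3)^[N] z = z) {ε u v : Circle}
    (hε : IsSign ε) (hu : u ∈ V) (h : SignEquivalent V ε u v) : SignEquivalent V ε v u := by
  obtain ⟨t, hV, rfl⟩ := h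
  obtain ⟨s, hs, hs'⟩ := hε.exists_inverse_image hN hfix t
  exact ⟨s, by rwa [hV] at hs, hs' u hu⟩

lemma SignEquivalent.trans {ε ε' u v w : Circle} (hε : IsSign ε) (h : SignEquivalent V ε u v)
    (h' : SignEquivalent V ε' v w) : SignEquivalent V (ε' * ε) u w := by
  obtain ⟨t, hV, rfl⟩ := h
  obtain ⟨t', hV', rfl⟩ := h'
  refine ⟨t' + t, ?_, (hε.tau_tau t' t u).symm⟩
  rw [← funext (hε.tau_tau t' t), ← Function.comp_def, Set.image_comp, hV, hV']

lemma Equivalent.symm (hN : 0 < N) (hfix : ∀ z ∈ V, (sigma 3)^[N] z = z) {u v : Circle}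
    (hu : u ∈ V) (h : Equivalent V u v) : Equivalent V v u := by
  obtain ⟨ε, hε, h⟩ := h
  exact ⟨ε, hε, h.symm hN hfix hε hu⟩

lemma Equivalent.trans {u v w : Circle} (h : Equivalent V u v) (h' : Equivalent V v w) :
    Equivalent V u w := by
  obtain ⟨ε, hε, h⟩ := h
  obtain ⟨ε', hε', h'⟩ := h'
  exact ⟨ε' * ε, hε'.mul hε, h.trans hε h'⟩

/-- If images of two polygons share an oriented side, then the corresponding vertices are
equivalent. -/
lemma equivalent_of_tau_eq (hN : 0 < N) (hfix : ∀ z ∈ V, (sigma 3)^[N] z = z) {ε ε' : Circle}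
    (hε : IsSign ε) (hε' : IsSign ε') {t t' : ℕ} {u v : Circle} (hv : v ∈ V)
    (hV : tau ε t '' V = tau ε' t' '' V) (h : tau ε t u = tau ε' t' v) : Equivalent V u v := by
  obtain ⟨s, hs, hs'⟩ := hε'.exists_inverse_image hN hfix t'
  refine ⟨ε' * ε, hε'.mul hε, s + t, ?_, ?_⟩
  · rw [← funext (hε.tau_tau s t), ← Function.comp_def, Set.image_comp, hV, hs]
  · rw [← hε.tau_tau, h, hs' v hv]

/-- The first counterexample met when going round from `v` has a predecessor that is not one. -/
lemma IsPrePolygon.cons_induction (hV : IsPrePolygon L V) {P : Circle → Prop} {v : Circle}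
    (hv : v ∈ V) (hP : P v) (hcons : ∀ a b, Cons V a b → P a → P b) : ∀ z ∈ V, P z := by
  by_contra! hcon
  obtain ⟨z₀, hz₀, hne₀⟩ := hcon
  obtain ⟨z, ⟨hz, hne⟩, hmin⟩ := Set.exists_min_image {z | z ∈ V ∧ ¬ P z} (arc v)
    (hV.finite.subset fun z hz => hz.1) ⟨z₀, hz₀, hne₀⟩
  obtain ⟨y, hy⟩ := hV.exists_prev hz
  have hzv : z ≠ v := by rintro rfl; exact hne hP
  have hyz : arc v y < arc v z := by
    by_contra! hle
    rcases arc_cases v y z with ⟨e1, -⟩ | ⟨e1, e2⟩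
    · exact hy.ne (arc_right_injective v (le_antisymm e1 hle))
    · have hvy : v ≠ y := by
        rintro rfl
        rw [arc_self] at e1
        linarith [arc_nonneg v z]
      have := hy.le v hv hvy
      have := arc_add_arc hvy
      have := arc_pos hzv.symm
      linarith
  refine hne (hcons y z hy ?_)
  by_contra hne'
  linarith [hmin y ⟨hy.left_mem, hne'⟩]

lemma IsPrePolygon.tau_eq_self (hV : IsPrePolygon L V) (hL : IsInvariantLamination 3 L)
    (hN : 0 < N) (hfix : ∀ z ∈ V, (sigma 3)^[N] z = z) {ε : Circle} {t : ℕ}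
    (him : tau ε t '' V = V) {v : Circle} (hv : v ∈ V) (hvv : tau ε t v = v) :
    ∀ z ∈ V, tau ε t z = z := by
  refine hV.cons_induction hv hvv fun a b hab ha => ?_
  have h1 := hV.cons_tau hL hN hfix ε t hab
  rw [him, ha] at h1
  exact h1.right_unique hab

lemma len_mul_left (ε a b : Circle) : len (ε * a) (ε * b) = len a b := by simp [len]

/-- In the orbit of a side there is a chord whose image is the shortest chord of the orbit. -/
lemma exists_min_len (hN : 0 < N) {u u' : Circle} (hu : (sigma 3)^[N] u = u)
    (hu' : (sigma 3)^[N] u' = u') (hne : u ≠ u') : ∃ t a b,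
      ((a = (sigma 3)^[t] u ∧ b = (sigma 3)^[t] u') ∨
        (a = (sigma 3)^[t] u' ∧ b = (sigma 3)^[t] u)) ∧ sigma 3 a ≠ sigma 3 b ∧
      1 / 6 < arc a b ∧ arc a b ≤ 1 / 2 ∧
      len (sigma 3 a) (sigma 3 b) = 3 * |arc a b - 1 / 3| ∧
      ∀ s, len (sigma 3 a) (sigma 3 b) ≤ len ((sigma 3)^[s] u) ((sigma 3)^[s] u') := by
  have hmod : ∀ {z : Circle}, (sigma 3)^[N] z = z → ∀ s,
      (sigma 3)^[s % N] z = (sigma 3)^[s] z := fun {z} hz s => by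
    conv_rhs => rw [← Nat.mod_add_div s N, Function.iterate_add_apply, iterate_mul_eq hz]
  obtain ⟨m, -, hm⟩ := Finset.exists_min_image (Finset.range N)
    (fun s => len ((sigma 3)^[s] u) ((sigma 3)^[s] u')) ⟨0, Finset.mem_range.2 hN⟩
  have hmin : ∀ s, len ((sigma 3)^[m] u) ((sigma 3)^[m] u') ≤
      len ((sigma 3)^[s] u) ((sigma 3)^[s] u') := fun s => by
    have := hm (s % N) (Finset.mem_range.2 (Nat.mod_lt _ hN))
    simpa only [hmod hu, hmod hu'] using this
  -- The time just before `m`; adding `N` keeps the subtraction harmless when `m = 0`.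
  have key : ∀ {z : Circle}, (sigma 3)^[N] z = z →
      sigma 3 ((sigma 3)^[m + N - 1] z) = (sigma 3)^[m] z := fun {z} hz => by
    rw [← Function.iterate_succ_apply' (sigma 3), Nat.succ_eq_add_one,
      show m + N - 1 + 1 = m + N by omega, Function.iterate_add_apply, hz]
  have hne1 : (sigma 3)^[m + N - 1] u ≠ (sigma 3)^[m + N - 1] u' :=
    (iterate_injOn hN _).ne hu hu' hne
  have hne2 : (sigma 3)^[m] u ≠ (sigma 3)^[m] u' := (iterate_injOn hN _).ne hu hu' hne
  rcases arc_le_half_or hne1 with h | h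
  · have h6 := one_sixth_lt hne1 h (by rw [key hu, key hu']; exact hmin _)
    refine ⟨m + N - 1, _, _, Or.inl ⟨rfl, rfl⟩, by rwa [key hu, key hu'], h6, h,
      len_sigma h6.le h, ?_⟩
    rw [key hu, key hu']
    exact hmin
  · have h6 := one_sixth_lt hne1.symm h
      (by rw [key hu, key hu', len_comm, len_comm _ ((sigma 3)^[m + N - 1] u)]; exact hmin _)
    refine ⟨m + N - 1, _, _, Or.inr ⟨rfl, rfl⟩, by rw [key hu, key hu']; exact hne2.symm, h6, h,
      len_sigma h6.le h, ?_⟩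
    rw [key hu, key hu', len_comm]
    exact hmin

/-- The main step: the side of minimal length among all sides of the images of a polygon is
contained in an image of the polygon in which a side not equivalent to it faces the origin. -/
lemma IsPolygon.exists_shortest (hV : IsPolygon L V) (hL : IsSymmetricLamination L) (hN : 0 < N)
    (hfix : ∀ z ∈ V, (sigma 3)^[N] z = z) : ∃ u ∈ V, ∃ T : ℕ, ∀ v v', Cons V v v' →
      ¬ Equivalent V u v → 1 / 2 ≤ arc ((sigma 3)^[T] v) ((sigma 3)^[T] v') := by
  have hLi := hL.toIsInvariantLamination
  have hLl := hLi.toIsLamination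
  have hnext : ∀ z : V, ∃ z', Cons V z z' := fun z => hV.exists_next z.2
  choose nx hnx using hnext
  obtain ⟨z₀, hz₀, -⟩ := hV.three 1 1
  have hfin : Finite V := hV.finite
  have hlen : ∀ z : V, ∃ t a b,
      ((a = (sigma 3)^[t] (z : Circle) ∧ b = (sigma 3)^[t] (nx z)) ∨
        (a = (sigma 3)^[t] (nx z) ∧ b = (sigma 3)^[t] (z : Circle))) ∧ sigma 3 a ≠ sigma 3 b ∧
      1 / 6 < arc a b ∧ arc a b ≤ 1 / 2 ∧
      len (sigma 3 a) (sigma 3 b) = 3 * |arc a b - 1 / 3| ∧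
      ∀ s, len (sigma 3 a) (sigma 3 b) ≤ len ((sigma 3)^[s] (z : Circle)) ((sigma 3)^[s] (nx z)) :=
    fun z => exists_min_len hN (hfix z z.2) (hfix _ (hnx z).right_mem) (hnx z).ne
  choose τ a b hab hne h6 h2 hl hmin using hlen
  have : Nonempty V := ⟨⟨z₀, hz₀⟩⟩
  -- The orbit of this side contains the shortest chord among all sides of all images of `V`.
  obtain ⟨u, hu⟩ := Finite.exists_min fun z : V => len (sigma 3 (a z)) (sigma 3 (b z))
  have hleaf : ∀ z : V, s(a z, b z) ∈ L := fun z => by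
    have := leaf_iterate hLi hN (hfix z z.2) (hfix _ (hnx z).right_mem) (hnx z).ne
      (hV.leaf _ _ (hnx z)) (τ z)
    rcases hab z with ⟨h, h'⟩ | ⟨h, h'⟩
    · rwa [h, h']
    · rwa [h, h', Sym2.eq_swap]
  have hg : ∀ ε t c d, Cons (tau ε t '' V) c d → len (sigma 3 (a u)) (sigma 3 (b u)) ≤ len c d := by
    intro ε t c d h
    obtain ⟨w, hw, rfl⟩ := h.left_mem
    rw [h.right_unique (hV.cons_tau hLi hN hfix ε t (hnx ⟨w, hw⟩)), tau, tau, len_mul_left]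
    exact (hu ⟨w, hw⟩).trans (hmin ⟨w, hw⟩ t)
  have himg : ∀ z : V, s(sigma 3 (a z), sigma 3 (b z)) =
      s((sigma 3)^[τ z + 1] (z : Circle), (sigma 3)^[τ z + 1] (nx z)) := fun z => by
    rw [Function.iterate_succ_apply', Function.iterate_succ_apply']
    rcases hab z with ⟨h, h'⟩ | ⟨h, h'⟩
    · rw [h, h']
    · rw [h, h', Sym2.eq_swap]
  refine ⟨u, u.2, τ u + 1, fun v v' hv hnot => ?_⟩
  obtain ⟨v, hvV⟩ : ∃ w : V, (w : Circle) = v := ⟨⟨v, hv.left_mem⟩, rfl⟩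
  subst hvV
  obtain rfl := hv.right_unique (hnx v)
  -- Minimality of `u` says that its leaf is at least as close to length `1/3` as that of `v`, so
  -- its image is trapped under the chord `r r'`.
  obtain ⟨η, r, r', hη, hrr', hrlen, hra, hrb⟩ := hL.exists_nested (hleaf v) (hne v) (h6 v) (h2 v)
    (hleaf u) (hne u) (by have := hu v; simp only [hl] at this; linarith)
  have hQ := hV.image_tau hL hN hfix (Or.inl rfl) (τ u + 1)
  have hW := hV.image_tau hL hN hfix hη (τ v + 1)
  have hQc := hV.cons_tau hLi hN hfix 1 (τ u + 1) (hnx u)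
  have hWc := hV.cons_tau hLi hN hfix η (τ v + 1) (hnx v)
  set x := tau 1 (τ u + 1) u with hx
  set y := tau 1 (τ u + 1) (nx u) with hy
  set x' := tau η (τ v + 1) v with hx'
  set y' := tau η (τ v + 1) (nx v) with hy'
  set Q := tau 1 (τ u + 1) '' V with hQdef
  set W := tau η (τ v + 1) '' V with hWdef
  have hxy : s(sigma 3 (a u), sigma 3 (b u)) = s(x, y) := by
    rw [himg u, hx, hy, tau_one]
  have hxy' : s(r, r') = s(x', y') := by
    rw [hrr', hx', hy', tau, tau]
    have := congrArg (Sym2.map (η * ·)) (himg v)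
    simpa only [Sym2.map_mk] using this
  have hxylen : len x y = len (sigma 3 (a u)) (sigma 3 (b u)) := by
    rcases Sym2.eq_iff.1 hxy with h | h <;> rw [h.1, h.2]
    rw [len_comm]
  have hrx : arc r x ≤ arc r r' ∧ arc r y ≤ arc r r' := by
    rcases Sym2.eq_iff.1 hxy with h | h <;> rw [← h.1, ← h.2]
    exacts [⟨hra, hrb⟩, ⟨hrb, hra⟩]
  have hrne : r ≠ r' := by
    rintro rfl
    rcases Sym2.eq_iff.1 hxy' with h | h
    · exact hWc.ne (h.1.symm.trans h.2)
    · exact hWc.ne (h.2.symm.trans h.1)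
  have hleafr : s(r, r') ∈ L := by rw [hxy']; exact hW.leaf _ _ hWc
  have hhalf : arc r r' ≤ 1 / 2 := by
    rw [hrlen]
    have := h6 v
    have := h2 v
    have : |arc (a v) (b v) - 1 / 3| ≤ 1 / 6 := by rw [abs_le]; constructor <;> linarith
    linarith
  have hunder : ∀ z ∈ Q, arc r z ≤ arc r r' := by
    refine (hQ.side hLl hrne hleafr).resolve_right fun hside => ?_
    -- Were `Q` on the other side of `r r'`, its shortest side would lie on both closed sides and
    -- coincide with `r r'`.
    have hmem : ∀ z, arc r z ≤ arc r r' → arc r' z ≤ arc r' r → z = r ∨ z = r' := by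
      intro z h1 h2
      have hs := arc_add_arc hrne
      rcases arc_cases r r' z with ⟨e1, -⟩ | ⟨e1, e2⟩
      · exact Or.inr (arc_right_injective r (le_antisymm h1 e1))
      · exact Or.inl (arc_eq_zero.1 (by linarith [arc_nonneg r z])).symm
    have hx1 := hmem x hrx.1 (hside x hQc.left_mem)
    have hy1 := hmem y hrx.2 (hside y hQc.right_mem)
    have hset : s(x, y) = s(x', y') := by
      rw [← hxy']
      have := hQc.ne
      rcases hx1 with h | h <;> rcases hy1 with h' | h' <;> rw [h, h'] at this ⊢
      · exact absurd rfl this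
      · exact Sym2.eq_swap
      · exact absurd rfl this
    -- With equal orientations the polygons agree and `u`, `v` are equivalent. With opposite ones
    -- they lie on opposite sides of the shared chord, and the one over its short arc has a shorter
    -- side, against minimality.
    rcases Sym2.eq_iff.1 hset with ⟨h, h'⟩ | ⟨h, h'⟩
    · have hQW : Q = W := hQ.eq_of_cons hW hLl hQc (by rwa [h, h'])
      exact hnot (equivalent_of_tau_eq hN hfix (Or.inl rfl) hη v.2 hQW h)
    · rcases arc_le_half_or hQc.ne with hle | hle
      · obtain ⟨c, d, hcd, hlt⟩ := hW.exists_shorter hWc (by rwa [← h, ← h'])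
        have := hg _ _ _ _ hcd
        rw [← h, ← h', len_comm y x] at hlt
        linarith
      · obtain ⟨c, d, hcd, hlt⟩ := hQ.exists_shorter hQc hle
        have := hg _ _ _ _ hcd
        linarith
  have hvc := hV.cons_tau hLi hN hfix 1 (τ u + 1) (hnx v)
  have hfinal := hQ.half_le_arc hhalf hunder hvc (by
    rw [hrlen, ← hl, tau_one]
    exact hmin v _)
  rwa [tau_one] at hfinal

/-- Any two vertices of a periodic polygon are equivalent. -/
lemma IsPolygon.equivalent (hV : IsPolygon L V) (hL : IsSymmetricLamination L) (hN : 0 < N)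
    (hfix : ∀ z ∈ V, (sigma 3)^[N] z = z) {v w : Circle} (hv : v ∈ V) (hw : w ∈ V) :
    Equivalent V v w := by
  have hLi := hL.toIsInvariantLamination
  obtain ⟨u, hu, T, hT⟩ := hV.exists_shortest hL hN hfix
  -- Two exceptional vertices would give two sides of `σ₃ᵀ V` that each span at least half the
  -- circle.
  have huniq : ∀ v w, v ∈ V → w ∈ V → ¬ Equivalent V u v → ¬ Equivalent V u w → v = w := by
    intro v w hv hw hvu hwu
    obtain ⟨v', hv'⟩ := hV.exists_next hv
    obtain ⟨w', hw'⟩ := hV.exists_next hw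
    obtain ⟨hQ, hc⟩ := hV.iterate hLi hN hfix T
    exact iterate_injOn hN T (hfix v hv) (hfix w hw) (hQ.eq_of_half_le (hc _ _ hv') (hc _ _ hw')
      (hT _ _ hv' hvu) (hT _ _ hw' hwu))
  have hall : ∀ v ∈ V, Equivalent V u v := by
    by_contra! hcon
    obtain ⟨p, hp, hpu⟩ := hcon
    obtain ⟨w, hw, hwu, hwp⟩ := hV.three u p
    have hw' : Equivalent V u w := by
      by_contra h
      exact hwp (huniq w p hw hp h hpu)
    obtain ⟨ε, hε, t, him, rfl⟩ := hw'
    have hpV : tau ε t p ∈ V := by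
      have : tau ε t p ∈ tau ε t '' V := ⟨p, hp, rfl⟩
      rwa [him] at this
    -- The map preserves equivalence classes, and `p` is the only vertex outside the class of `u`.
    have hpp : tau ε t p = p := huniq _ _ hpV hp
      (fun h => hpu (h.trans (Equivalent.symm hN hfix hp ⟨ε, hε, t, him, rfl⟩))) hpu
    exact hwu (hV.tau_eq_self hLi hN hfix him hp hpp u hu)
  exact (Equivalent.symm hN hfix hu (hall v hv)).trans (hall w hw)

/-! ### Gaps with finitely many vertices -/

/-- Points of the circle are extreme in the closed disk, so a hull acquires no new ones. -/
lemma vertices_hull (A : Set Circle) : vertices (hull A) = A := by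
  have hsub : hull A ⊆ Metric.closedBall (0 : ℂ) 1 := by
    refine convexHull_min ?_ (convex_closedBall _ _)
    rintro _ ⟨z, -, rfl⟩
    simp [Circle.norm_coe]
  ext z
  refine ⟨fun hz => ?_, fun hz => subset_convexHull ℝ _ ⟨z, hz, rfl⟩⟩
  have hz' : (z : ℂ) ∈ hull A := hz
  have hext : (z : ℂ) ∈ (Metric.closedBall (0 : ℂ) 1).extremePoints ℝ := by
    rw [StrictConvexSpace.extremePoints_closedBall_eq_sphere]
    simp [Circle.norm_coe]
  obtain ⟨w, hw, hwz⟩ := extremePoints_convexHull_subset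
    (inter_extremePoints_subset_extremePoints_of_subset hsub ⟨hz', hext⟩)
  rwa [← Circle.ext hwz]

lemma vertices_sigmaGap_iterate (G : Set ℂ) (t : ℕ) :
    vertices ((sigmaGap 3)^[t] G) = (sigma 3)^[t] '' vertices G := by
  induction t with
  | zero => simp
  | succ t ih =>
    rw [Function.iterate_succ_apply', sigmaGap, vertices_hull, ih, Function.iterate_succ',
      Set.image_comp]

lemma sigmaGap_iterate_eq_hull (hG : G = hull (vertices G)) (t : ℕ) :
    (sigmaGap 3)^[t] G = hull ((sigma 3)^[t] '' vertices G) := by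
  cases t with
  | zero => simpa using hG
  | succ t =>
    rw [Function.iterate_succ_apply', sigmaGap, vertices_sigmaGap_iterate, Function.iterate_succ',
      Set.image_comp]

/-- Every value of `sigmaGap` is a hull, and a periodic gap is such a value. -/
lemma IsPeriodicPolygon.eq_hull (hG : IsPeriodicPolygon L G) : G = hull (vertices G) := by
  obtain ⟨k, hk, h⟩ := hG.periodic
  obtain ⟨m, rfl⟩ := Nat.exists_eq_succ_of_ne_zero hk.ne'
  rw [Function.iterate_succ_apply', sigmaGap] at h
  rw [← h, vertices_hull]

lemma area_ne_zero {a b c : Circle} (hab : a ≠ b) (hac : a ≠ c) (hbc : b ≠ c) :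
    area a b c ≠ 0 := by
  have h1 := arc_pos hab
  have h2 := arc_pos hac
  rcases lt_trichotomy (arc a b) (arc a c) with h | h | h
  · exact (area_pos (r := a) (by simpa using h1) h).ne'
  · exact absurd (arc_right_injective a h) hbc
  · have := area_pos (r := a) (a := a) (by simpa using h2) h
    have e : area a b c = -area a c b := by simp only [area]; ring
    rw [e]
    linarith

/-- On the line, `x = a + s (b - a)` and `|x|² = 1 - s (1 - s) |b - a|²`, so being inside the disk
forces `0 < s < 1`. -/
lemma mem_segment_of_area_eq_zero {a b : Circle} {x : ℂ} (hab : a ≠ b)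
    (hx : x ∈ Metric.ball (0 : ℂ) 1) (h : area a b x = 0) : x ∈ segment ℝ (a : ℂ) (b : ℂ) := by
  have hne : (a : ℂ) ≠ b := fun e => hab (Circle.ext e)
  have ha : (a : ℂ).re ^ 2 + (a : ℂ).im ^ 2 = 1 := by
    have := Circle.normSq_coe a
    rw [Complex.normSq_apply] at this
    linarith
  have hb : (b : ℂ).re ^ 2 + (b : ℂ).im ^ 2 = 1 := by
    have := Circle.normSq_coe b
    rw [Complex.normSq_apply] at this
    linarith
  have hx' : x.re ^ 2 + x.im ^ 2 < 1 := by
    rw [mem_ball_zero_iff] at hx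
    have := Complex.normSq_eq_norm_sq x
    rw [Complex.normSq_apply] at this
    nlinarith [norm_nonneg x]
  set p := (b : ℂ).re - (a : ℂ).re with hp
  set q := (b : ℂ).im - (a : ℂ).im with hq
  have hD : 0 < p ^ 2 + q ^ 2 := by
    by_contra! hD
    have hp0 : p = 0 := by nlinarith [sq_nonneg p, sq_nonneg q]
    have hq0 : q = 0 := by nlinarith [sq_nonneg p, sq_nonneg q]
    exact hne (Complex.ext (by linarith) (by linarith))
  set s := ((x.re - (a : ℂ).re) * p + (x.im - (a : ℂ).im) * q) / (p ^ 2 + q ^ 2) with hs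
  have hsD : s * (p ^ 2 + q ^ 2) = (x.re - (a : ℂ).re) * p + (x.im - (a : ℂ).im) * q := by
    rw [hs]; field_simp
  have h' : p * (x.im - (a : ℂ).im) - q * (x.re - (a : ℂ).re) = 0 := h
  have e1 : x.re = (a : ℂ).re + s * p := by
    have : (x.re - (a : ℂ).re - s * p) * (p ^ 2 + q ^ 2) = 0 := by
      linear_combination (-p) * hsD - q * h'
    rcases mul_eq_zero.1 this with h0 | h0 <;> linarith
  have e2 : x.im = (a : ℂ).im + s * q := by
    have : (x.im - (a : ℂ).im - s * q) * (p ^ 2 + q ^ 2) = 0 := by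
      linear_combination (-q) * hsD + p * h'
    rcases mul_eq_zero.1 this with h0 | h0 <;> linarith
  have e3 : (a : ℂ).re * p + (a : ℂ).im * q = -(p ^ 2 + q ^ 2) / 2 := by
    have hb' : ((a : ℂ).re + p) ^ 2 + ((a : ℂ).im + q) ^ 2 = 1 := by
      rw [hp, hq]; linear_combination hb
    linear_combination hb' / 2 - ha / 2
  have e4 : 0 < s * (1 - s) * (p ^ 2 + q ^ 2) := by
    rw [e1, e2] at hx'
    have : ((a : ℂ).re + s * p) ^ 2 + ((a : ℂ).im + s * q) ^ 2 =
        1 - s * (1 - s) * (p ^ 2 + q ^ 2) := by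
      linear_combination ha + 2 * s * e3
    linarith
  have e5 : 0 < s * (1 - s) := by
    by_contra! hle
    nlinarith
  refine ⟨1 - s, s, by nlinarith, by nlinarith, by ring, ?_⟩
  apply Complex.ext
  · simp [e1, hp]; ring
  · simp [e2, hq]; ring

/-- Moving perpendicularly to the chord lowers the area. Hence no interior point of a set in the
half-plane `0 ≤ area a b` lies on its boundary line. -/
lemma exists_area_lt {U : Set ℂ} (hU : IsOpen U) {x : ℂ} (hx : x ∈ U) {a b : Circle}
    (hab : a ≠ b) : ∃ y ∈ U, area a b y < area a b x := by
  have hne : (b : ℂ) - a ≠ 0 := fun e => hab (Circle.ext (sub_eq_zero.1 e).symm)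
  have hn : 0 < Complex.normSq ((b : ℂ) - a) := Complex.normSq_pos.2 hne
  let f : ℝ → ℂ := fun ε => x - ε * (Complex.I * ((b : ℂ) - a))
  have hf : Continuous f := by fun_prop
  have h0 : f 0 ∈ U := by simpa [f] using hx
  have hev : ∀ᶠ ε in nhdsWithin (0 : ℝ) (Set.Ioi 0), f ε ∈ U :=
    nhdsWithin_le_nhds (hf.continuousAt.preimage_mem_nhds (hU.mem_nhds h0))
  obtain ⟨ε, hε, hpos⟩ := (hev.and self_mem_nhdsWithin).exists
  refine ⟨f ε, hε, ?_⟩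
  have : area a b (f ε) = area a b x - ε * Complex.normSq ((b : ℂ) - a) := by
    simp [f, area, Complex.normSq_apply]
    ring
  rw [this]
  have := mul_pos (Set.mem_Ioi.1 hpos) hn
  linarith

lemma convex_area_nonneg (a b : ℂ) : Convex ℝ {x | 0 ≤ area a b x} := by
  intro x hx y hy s t hs ht hst
  show 0 ≤ area a b (s • x + t • y)
  rw [area_combo _ _ _ _ hst]
  have hx' : 0 ≤ area a b x := hx
  have hy' : 0 ≤ area a b y := hy
  positivity

/-- A gap lies on one side of every leaf. -/
lemma IsLamination.gap_side (hG : IsGap L G) {a b : Circle} (hab : a ≠ b) (h : s(a, b) ∈ L) :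
    (∀ x ∈ G, 0 ≤ area a b x) ∨ ∀ x ∈ G, area a b x ≤ 0 := by
  obtain ⟨z, -, rfl⟩ := hG
  set U := connectedComponentIn (Metric.ball (0 : ℂ) 1 \ support L) z
  have hU : U ⊆ Metric.ball (0 : ℂ) 1 \ support L := connectedComponentIn_subset _ _
  have hne : ∀ x ∈ U, area a b x ≠ 0 := by
    intro x hx h0
    refine (hU hx).2 (Set.mem_biUnion h ?_)
    rw [chord_eq_segment]
    exact mem_segment_of_area_eq_zero hab (hU hx).1 h0
  have hcont := continuous_area (a : ℂ) (b : ℂ)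
  have hside : (∀ x ∈ U, 0 ≤ area a b x) ∨ ∀ x ∈ U, area a b x ≤ 0 := by
    by_contra! hcon
    obtain ⟨⟨x, hx, hx0⟩, ⟨y, hy, hy0⟩⟩ := hcon
    obtain ⟨w, hw, hw0⟩ := isPreconnected_connectedComponentIn.intermediate_value hx hy
      hcont.continuousOn ⟨hx0.le, hy0.le⟩
    exact hne w hw hw0
  refine hside.imp (fun hs x hx => ?_) fun hs x hx => ?_
  · exact closure_minimal (t := {x | 0 ≤ area a b x}) hs
      (isClosed_le continuous_const hcont) hx
  · exact closure_minimal (t := {x | area a b x ≤ 0}) hs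
      (isClosed_le hcont continuous_const) hx

lemma Cons.area_nonneg {V : Set Circle} {a b : Circle} (h : Cons V a b) {x : ℂ}
    (hx : x ∈ hull V) : 0 ≤ area a b x := by
  refine convexHull_min ?_ (convex_area_nonneg (a : ℂ) b) hx
  rintro _ ⟨z, hz, rfl⟩
  show 0 ≤ area a b z
  rcases eq_or_ne z a with rfl | hza
  · simp [area]
  rcases eq_or_ne z b with rfl | hzb
  · simp [area, mul_comm]
  refine (area_pos (r := a) (by simpa using arc_pos h.ne) ?_).le
  exact lt_of_le_of_ne (h.le z hz hza) fun e => hzb (arc_right_injective a e).symm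

lemma isOpen_gap_interior (hL : IsLamination L) (z : ℂ) :
    IsOpen (connectedComponentIn (Metric.ball (0 : ℂ) 1 \ support L) z) :=
  (Metric.isOpen_ball.sdiff hL.isClosed).connectedComponentIn

lemma coe_mem_hull {V : Set Circle} {a : Circle} (ha : a ∈ V) : (a : ℂ) ∈ hull V :=
  subset_convexHull ℝ _ ⟨a, ha, rfl⟩

lemma chord_subset_hull {V : Set Circle} {a b : Circle} (ha : a ∈ V) (hb : b ∈ V) :
    chord s(a, b) ⊆ hull V := by
  rw [chord_eq_segment]
  exact (convex_convexHull ℝ _).segment_subset (coe_mem_hull ha) (coe_mem_hull hb)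

/-- Consecutive vertices of a gap that is spanned by its vertices are joined by a leaf. -/
lemma leaf_of_cons (hL : IsLamination L) (hG : IsGap L G) (hull_eq : G = hull (vertices G))
    {a b : Circle} (h : Cons (vertices G) a b) : s(a, b) ∈ L := by
  have hG' := hG
  obtain ⟨z, hz, hGz⟩ := hG'
  set O := Metric.ball (0 : ℂ) 1 \ support L with hO
  set x : ℂ := (1 / 2 : ℝ) • (a : ℂ) + (1 / 2 : ℝ) • (b : ℂ) with hx
  have hxball : x ∈ Metric.ball (0 : ℂ) 1 :=
    openSegment_mem_ball h.ne (by norm_num) (by norm_num) (by norm_num)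
  have hxG : x ∈ G := by
    rw [hull_eq]
    exact (convex_convexHull ℝ _) (coe_mem_hull h.left_mem) (coe_mem_hull h.right_mem)
      (by norm_num) (by norm_num) (by norm_num)
  -- If the midpoint `x` were off the leaves, its component would meet that of the gap, hence equal
  -- it, and `G` would extend beyond the line `a b`.
  have hxsup : x ∈ support L := by
    by_contra hns
    have hxO : x ∈ O := ⟨hxball, hns⟩
    have hopen := isOpen_gap_interior hL x
    have hmem : x ∈ connectedComponentIn O x := mem_connectedComponentIn hxO
    obtain ⟨w, hw1, hw2⟩ := mem_closure_iff.1 (hGz ▸ hxG) _ hopen hmem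
    have heq : connectedComponentIn O x = connectedComponentIn O z := by
      rw [connectedComponentIn_eq hw1, connectedComponentIn_eq hw2]
    obtain ⟨y, hy, hlt⟩ := exists_area_lt hopen hmem h.ne
    have hyG : y ∈ G := by
      rw [hGz]
      exact subset_closure (heq ▸ hy)
    have h1 := h.area_nonneg (hull_eq ▸ hyG)
    have h2 : area a b x = 0 := by rw [hx]; simp [area]; ring
    linarith
  obtain ⟨e, he, hxe⟩ := Set.mem_iUnion₂.1 hxsup
  induction e using Sym2.ind with
  | _ c d =>
    rcases eq_or_ne c d with rfl | hcd
    · rw [chord_eq_segment, segment_same] at hxe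
      rw [Set.mem_singleton_iff.1 hxe] at hxball
      simp [Circle.norm_coe] at hxball
    · have hzero : area c d x = 0 := by
        rw [chord_eq_segment] at hxe
        obtain ⟨s, t, -, -, hst, hxst⟩ := hxe
        rw [← hxst, area_combo _ _ _ _ hst]
        simp [area, mul_comm]
      have hsum : area c d x = 1 / 2 * area c d a + 1 / 2 * area c d b := by
        rw [hx, area_combo _ _ _ _ (by norm_num)]
      have haG : (a : ℂ) ∈ G := h.left_mem
      have hbG : (b : ℂ) ∈ G := h.right_mem
      -- The area vanishes at the midpoint and has one sign at both `a` and `b`, so it vanishes at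
      -- both.
      have h0 : area c d a = 0 ∧ area c d b = 0 := by
        rcases IsLamination.gap_side hG hcd he with hs | hs
        · have := hs _ haG
          have := hs _ hbG
          constructor <;> linarith
        · have := hs _ haG
          have := hs _ hbG
          constructor <;> linarith
      have key : ∀ w : Circle, area c d w = 0 → w = c ∨ w = d := by
        intro w hw
        by_contra! hne
        exact area_ne_zero hcd hne.1.symm hne.2.symm hw
      have hab := h.ne
      rcases key a h0.1 with h1 | h1 <;> rcases key b h0.2 with h2 | h2 <;> rw [h1, h2] at hab ⊢
      · exact absurd rfl hab
      · exact he
      · rwa [Sym2.eq_swap]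
      · exact absurd rfl hab

/-- A gap with finitely many vertices that is spanned by them is a polygon. -/
lemma isPolygon_vertices (hL : IsLamination L) (hG : IsGap L G) (hull_eq : G = hull (vertices G))
    (hfin : (vertices G).Finite) : IsPolygon L (vertices G) where
  finite := hfin
  three := by
    -- With at most two vertices the hull would lie on a line, but a gap contains a nonempty open
    -- set.
    have key : ∀ a b : Circle, a ≠ b → ∃ c ∈ vertices G, c ≠ a ∧ c ≠ b := by
      intro a b hab
      by_contra! hcon
      obtain ⟨z, hz, hGz⟩ := hG
      have hopen := isOpen_gap_interior hL z
      have hmem := mem_connectedComponentIn hz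
      have hzero : ∀ {a b : Circle}, (∀ c ∈ vertices G, c ≠ a → c = b) →
          ∀ x ∈ G, 0 ≤ area a b x := by
        intro a b hcon x hx
        rw [hull_eq] at hx
        refine convexHull_min ?_ (convex_area_nonneg (a : ℂ) b) hx
        rintro _ ⟨c, hc, rfl⟩
        show 0 ≤ area a b c
        rcases eq_or_ne c a with rfl | hca
        · simp [area]
        · rw [hcon c hc hca]
          simp [area, mul_comm]
      have hcon' : ∀ c ∈ vertices G, c ≠ b → c = a := fun c hc hcb => by
        by_contra hca
        exact hcb (hcon c hc hca)
      obtain ⟨y, hy, hlt⟩ := exists_area_lt hopen hmem hab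
      have h1 := hzero hcon y (by rw [hGz]; exact subset_closure hy)
      have h2 := hzero hcon' z (by rw [hGz]; exact subset_closure hmem)
      rw [area_swap] at h2
      linarith
    intro a b
    rcases eq_or_ne a b with rfl | hab
    · obtain ⟨c, hc, hca, -⟩ := key a (-a) (Circle.neg_ne_self a).symm
      exact ⟨c, hc, hca, hca⟩
    · exact key a b hab
  leaf a b h := leaf_of_cons hL hG hull_eq h
  diag a ha b hb hab h := by
    refine (IsLamination.gap_side hG hab h).imp (fun hs => ?_) fun hs => ?_
    · refine ⟨ha, hb, hab, fun c hc hca => ?_⟩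
      by_contra! hlt
      have h1 := area_pos (r := a) (a := a) (by simpa using arc_pos hca.symm) hlt
      have h2 := hs c hc
      have h3 : area a b c = -area a c b := by simp only [area]; ring
      linarith
    · refine ⟨hb, ha, hab.symm, fun c hc hcb => ?_⟩
      by_contra! hlt
      have h1 := area_pos (r := b) (a := b) (by simpa using arc_pos hcb.symm) hlt
      have h2 := hs c hc
      rw [area_rot] at h1
      linarith

/-- A leaf in the boundary has its ends among the vertices, so `diag` makes them consecutive.
Conversely `area a b` is nonnegative on `G` and zero on the side, which keeps the side off the
interior. -/
lemma mem_edges_iff (hL : IsLamination L) (hG : IsGap L G) (hull_eq : G = hull (vertices G))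
    (hfin : (vertices G).Finite) {e : Sym2 Circle} :
    e ∈ edges L G ↔ ∃ a b, Cons (vertices G) a b ∧ e = s(a, b) := by
  have hV := isPolygon_vertices hL hG hull_eq hfin
  have hclosed : IsClosed G := by
    obtain ⟨z, -, hGz⟩ := hG
    rw [hGz]
    exact isClosed_closure
  constructor
  · rintro ⟨he, hnd, hfr⟩
    induction e using Sym2.ind with
    | _ a b =>
      have hab : a ≠ b := by simpa using hnd
      have hsub : chord s(a, b) ⊆ G := hfr.trans hclosed.frontier_subset
      rw [chord_eq_segment] at hsub
      rcases hV.diag a (hsub (left_mem_segment _ _ _)) b (hsub (right_mem_segment _ _ _)) hab he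
        with h | h
      · exact ⟨a, b, h, rfl⟩
      · exact ⟨b, a, h, Sym2.eq_swap⟩
  · rintro ⟨a, b, h, rfl⟩
    refine ⟨hV.leaf _ _ h, by simpa using h.ne, fun x hx => ?_⟩
    have hxG : x ∈ G := by
      rw [hull_eq]
      exact chord_subset_hull h.left_mem h.right_mem hx
    refine ⟨subset_closure hxG, fun hint => ?_⟩
    obtain ⟨y, hy, hlt⟩ := exists_area_lt isOpen_interior hint h.ne
    have h1 := h.area_nonneg (hull_eq ▸ interior_subset hy)
    have h2 : area a b x = 0 := by
      rw [chord_eq_segment] at hx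
      obtain ⟨s, t, -, -, hst, rfl⟩ := hx
      rw [area_combo _ _ _ _ hst]
      simp [area, mul_comm]
    linarith

/-! ### The order of the vertices -/

/-- The points of a finite subset of the circle, enumerated in counterclockwise order. -/
lemma exists_enumeration (hfin : V.Finite) (hne : V.Nonempty) : ∃ (n : ℕ) (θ : ℤ → ℝ), 0 < n ∧
    StrictMono θ ∧ (∀ i, θ (i + n) = θ i + 2 * Real.pi) ∧
    V = Set.range fun i => Circle.exp (θ i) := by
  have hpi := Real.pi_pos
  obtain ⟨v, hv⟩ := hne
  set S : Finset ℝ := (hfin.image (arc v)).toFinset with hS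
  have hmem : ∀ x, x ∈ S ↔ ∃ z ∈ V, arc v z = x := fun x => by simp [hS]
  obtain ⟨n, hn⟩ : ∃ n, S.card = n := ⟨_, rfl⟩
  have hn0 : 0 < n := by
    rw [← hn]
    exact Finset.card_pos.2 ⟨0, (hmem 0).2 ⟨v, hv, arc_self v⟩⟩
  have hnZ : (0 : ℤ) < n := by exact_mod_cast hn0
  set f := S.orderEmbOfFin hn with hf
  have hf01 : ∀ i, 0 ≤ f i ∧ f i < 1 := fun i => by
    obtain ⟨z, -, hz⟩ := (hmem _).1 (S.orderEmbOfFin_mem hn i)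
    rw [← hf] at hz
    rw [← hz]
    exact ⟨arc_nonneg _ _, arc_lt_one _ _⟩
  let r : ℤ → Fin n := fun i => ⟨(i % n).toNat, by
    have := Int.emod_lt_of_pos i hnZ
    have := Int.emod_nonneg i hnZ.ne'
    omega⟩
  -- The sorted coordinates of one turn, repeated with one extra turn for each passage through a
  -- multiple of `n`.
  let θ : ℤ → ℝ := fun i => Complex.arg v + 2 * Real.pi * (f (r i) + (i / n : ℤ))
  have hexp : ∀ i, Circle.exp (θ i) = v * turn (f (r i)) := fun i => by
    have h1 := turn_int (i / n)
    rw [Circle.exp_add, Circle.exp_arg]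
    change v * turn _ = _
    rw [turn_add, h1, mul_one]
  refine ⟨n, θ, hn0, strictMono_int_of_lt_succ fun i => ?_, fun i => ?_, ?_⟩
  · have key : f (r i) + (i / n : ℤ) < f (r (i + 1)) + ((i + 1) / n : ℤ) := by
      have h1 := Int.mul_ediv_add_emod i n
      have h2 := Int.emod_lt_of_pos i hnZ
      have h3 := Int.emod_nonneg i hnZ.ne'
      rcases lt_or_ge (i % n + 1) n with h | h
      · have h4 : (i + 1) / n = i / n := by
          rw [Int.ediv_eq_iff_of_pos hnZ]
          constructor <;> nlinarith
        have h5 : (i + 1) % n = i % n + 1 := by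
          have := Int.mul_ediv_add_emod (i + 1) n
          rw [h4] at this
          linarith
        rw [h4]
        have : r i < r (i + 1) := by
          simp only [r, Fin.lt_def, h5]
          omega
        have := f.strictMono this
        linarith
      · have h4 : (i + 1) / n = i / n + 1 := by
          rw [Int.ediv_eq_iff_of_pos hnZ]
          constructor <;> nlinarith
        rw [h4]
        push_cast
        have := (hf01 (r i)).2
        have := (hf01 (r (i + 1))).1
        linarith
    have := mul_lt_mul_of_pos_left key (by positivity : 0 < 2 * Real.pi)
    simp only [θ]
    linarith
  · have h1 : r (i + n) = r i := by simp [r]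
    have h2 : (i + n) / (n : ℤ) = i / n + 1 := by
      simpa using Int.add_mul_ediv_right i 1 hnZ.ne'
    simp only [θ, h1, h2]
    push_cast
    ring
  · ext z
    constructor
    · intro hz
      have : arc v z ∈ Set.range f := by
        rw [hf, Finset.range_orderEmbOfFin]
        exact (hmem _).2 ⟨z, hz, rfl⟩
      obtain ⟨i, hi⟩ := this
      refine ⟨i, ?_⟩
      have hr : r i = i := by
        ext
        have : ((i : ℕ) : ℤ) % n = i := Int.emod_eq_of_lt (by omega) (by omega)
        simp [r, this]
      simp only
      rw [hexp, hr, hi, mul_turn_arc]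
    · rintro ⟨i, rfl⟩
      obtain ⟨z, hz, hz'⟩ := (hmem _).1 (S.orderEmbOfFin_mem hn (r i))
      rw [← hf] at hz'
      simp only
      rwa [hexp, ← hz', mul_turn_arc]

lemma exp_add_int_mul {n : ℕ} {θ : ℤ → ℝ} (hper : ∀ i, θ (i + n) = θ i + 2 * Real.pi) (i m : ℤ) :
    Circle.exp (θ (i + n * m)) = Circle.exp (θ i) := by
  induction m using Int.induction_on with
  | zero => simp
  | succ m ih =>
    rw [← ih, mul_add, mul_one, ← add_assoc, hper, Circle.exp_add_two_pi]
  | pred m ih =>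
    rw [← ih, ← Circle.exp_add_two_pi, ← hper]
    congr 2
    ring

/-- Every other vertex has an index strictly between `i` and `i + n`, where arcs from the `i`-th
vertex grow with the index. -/
lemma cons_enumeration {n : ℕ} {θ : ℤ → ℝ} (hn : 0 < n) (hmono : StrictMono θ)
    (hper : ∀ i, θ (i + n) = θ i + 2 * Real.pi) (hV : V = Set.range fun i => Circle.exp (θ i))
    (htwo : ∀ a, ∃ c ∈ V, c ≠ a) (i : ℤ) :
    Cons V (Circle.exp (θ i)) (Circle.exp (θ (i + 1))) := by
  have hpi := Real.pi_pos
  have hnZ : (0 : ℤ) < n := by exact_mod_cast hn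
  have harc : ∀ m, i ≤ m → m < i + n →
      arc (Circle.exp (θ i)) (Circle.exp (θ m)) = (θ m - θ i) / (2 * Real.pi) := by
    intro m h1 h2
    have h3 := hmono.monotone h1
    have h4 := hmono h2
    rw [hper] at h4
    have : Circle.exp (θ m) = Circle.exp (θ i) * turn ((θ m - θ i) / (2 * Real.pi)) := by
      rw [turn, ← Circle.exp_add]
      congr 1
      field_simp
      ring
    rw [this, arc_mul_turn_of_lt]
    · exact div_nonneg (by linarith) (by positivity)
    · rw [div_lt_one (by positivity)]; linarith
  have hrep : ∀ c ∈ V, c ≠ Circle.exp (θ i) → ∃ m, i < m ∧ m < i + n ∧ c = Circle.exp (θ m) := by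
    intro c hc hne
    rw [hV] at hc
    obtain ⟨m, rfl⟩ := hc
    have h1 := Int.mul_ediv_add_emod (m - i) n
    have h2 := Int.emod_lt_of_pos (m - i) hnZ
    have h3 := Int.emod_nonneg (m - i) hnZ.ne'
    have h4 : Circle.exp (θ m) = Circle.exp (θ (i + (m - i) % n)) := by
      rw [← exp_add_int_mul hper (i + (m - i) % n) ((m - i) / n)]
      congr 2
      linarith
    refine ⟨i + (m - i) % n, ?_, by linarith, h4⟩
    rcases h3.lt_or_eq with h | h
    · linarith
    · exfalso
      apply hne
      simp only
      rw [h4, ← h, add_zero]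
  have hn2 : i + 1 < i + n := by
    obtain ⟨c, hc, hne⟩ := htwo (Circle.exp (θ i))
    obtain ⟨m, h1, h2, -⟩ := hrep c hc hne
    omega
  have hlt : θ i < θ (i + 1) := hmono (by omega)
  refine ⟨hV ▸ ⟨i, rfl⟩, hV ▸ ⟨i + 1, rfl⟩, ne_of_arc_pos ?_, fun c hc hne => ?_⟩
  · rw [harc _ (by omega) hn2]
    exact div_pos (by linarith) (by positivity)
  · obtain ⟨m, h1, h2, rfl⟩ := hrep c hc hne
    rw [harc _ (by omega) hn2, harc _ h1.le h2]
    have := hmono.monotone (show i + 1 ≤ m by omega)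
    gcongr

/-! ### Periodic orbits -/

lemma isPeriodicOrbit_range {α : Type*} {f : α → α} {x : α} {M : ℕ} (hM : 0 < M)
    (hx : f^[M] x = x) : IsPeriodicOrbit f (Set.range fun j => f^[j] x) := by
  have hper : ∀ j, f^[M] (f^[j] x) = f^[j] x := fun j => by
    rw [← Function.iterate_add_apply, add_comm, Function.iterate_add_apply, hx]
  obtain ⟨m, rfl⟩ := Nat.exists_eq_succ_of_ne_zero hM.ne'
  refine ⟨⟨x, 0, rfl⟩, ⟨?_, ?_, ?_⟩, ?_⟩
  · rintro _ ⟨j, rfl⟩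
    exact ⟨j + 1, Function.iterate_succ_apply' f j x⟩
  · rintro _ ⟨i, rfl⟩ _ ⟨j, rfl⟩ h
    have h1 := hper i
    have h2 := hper j
    rw [Function.iterate_succ_apply] at h1 h2
    simp only at h ⊢
    rw [← h1, ← h2, h]
  · rintro _ ⟨j, rfl⟩
    refine ⟨f^[m] (f^[j] x), ⟨m + j, Function.iterate_add_apply f m j x⟩, ?_⟩
    rw [← Function.iterate_succ_apply' f]
    exact hper j
  · rintro _ ⟨i, rfl⟩ _ ⟨j, rfl⟩
    -- The period is `m + 1`, so `m * i` further steps undo the first `i`.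
    refine ⟨j + m * i, ?_⟩
    have h1 : f^[m.succ * i] x = x := by
      rw [Function.iterate_mul]
      exact Function.iterate_fixed hx i
    rw [← Function.iterate_add_apply, show j + m * i + i = j + m.succ * i by
      rw [Nat.succ_mul, add_assoc], Function.iterate_add_apply, h1]

lemma sym2_map_iterate {α : Type*} (f : α → α) (j : ℕ) (a b : α) :
    (Sym2.map f)^[j] s(a, b) = s(f^[j] a, f^[j] b) := by
  induction j with
  | zero => rfl
  | succ j ih => simp only [Function.iterate_succ_apply', ih, Sym2.map_mk]

lemma exists_iterate_eq_self {α : Type*} {V : Set α} (hfin : V.Finite) {g : α → α}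
    (hg : g '' V = V) : ∃ M, 0 < M ∧ ∀ z ∈ V, g^[M] z = z := by
  have hmaps : Set.MapsTo g V V := fun z hz => by
    have : g z ∈ g '' V := ⟨z, hz, rfl⟩
    rwa [hg] at this
  have : Finite V := hfin
  have hsurj : Function.Surjective hmaps.restrict := by
    rintro ⟨z, hz⟩
    rw [← hg] at hz
    obtain ⟨w, hw, rfl⟩ := hz
    exact ⟨⟨w, hw⟩, rfl⟩
  let e : Equiv.Perm V := Equiv.ofBijective _ ⟨Finite.injective_iff_surjective.2 hsurj, hsurj⟩
  refine ⟨orderOf e, orderOf_pos e, fun z hz => ?_⟩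
  have h1 : (e ^ orderOf e) ⟨z, hz⟩ = ⟨z, hz⟩ := by rw [pow_orderOf_eq_one]; rfl
  have h2 : ∀ m : ℕ, (((e ^ m) ⟨z, hz⟩ : V) : α) = g^[m] z := fun m => by
    induction m with
    | zero => rfl
    | succ m ih =>
      rw [pow_succ', Function.iterate_succ_apply', ← ih]
      rfl
  rw [← h2, h1]

/-! ### Gaps opposite to each other -/

lemma neg_hull (A : Set Circle) : -hull A = hull ((fun z => -z) '' A) := by
  rw [hull, hull, ← convexHull_neg, Set.image_image, ← Set.image_neg_eq_neg, Set.image_image]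
  rfl

lemma negChord_mem_edges (hL : IsSymmetricLamination L) {e : Sym2 Circle} (he : e ∈ edges L G) :
    negChord e ∈ edges L (-G) := by
  obtain ⟨h1, h2, h3⟩ := he
  refine ⟨hL.symm e h1, ?_, ?_⟩
  · induction e using Sym2.ind with
    | _ a b => simpa [negChord] using h2
  · have hfr : frontier (-G) = -frontier G := ((Homeomorph.neg ℂ).preimage_frontier G).symm
    have hch : chord (negChord e) = -chord e := by
      rw [chord, chord, neg_hull]
      congr 1
      induction e using Sym2.ind with
      | _ a b =>
        ext z
        simp [negChord, Set.image, Sym2.mem_iff, or_and_right, exists_or, eq_comm]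
    rw [hfr, hch]
    exact Set.neg_subset_neg.2 h3

/-- A map that respects the cyclic order carries the whole side along with its first vertex. Adding
`N` to the exponent makes it positive. -/
lemma SignEquivalent.cons {ε : Circle} (hV : IsPrePolygon L V) (hL : IsInvariantLamination 3 L)
    (hN : 0 < N) (hfix : ∀ z ∈ V, (sigma 3)^[N] z = z) {a a' b b' : Circle}
    (ha : Cons V a a') (hb : Cons V b b') (h : SignEquivalent V ε a b) :
    ∃ t, 0 < t ∧ tau ε t '' V = V ∧ tau ε t a = b ∧ tau ε t a' = b' := by
  obtain ⟨t, him, rfl⟩ := h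
  have hadd : ∀ z ∈ V, tau ε (t + N) z = tau ε t z := fun z hz => by
    rw [tau, tau, Function.iterate_add_apply, hfix z hz]
  have h1 := hV.cons_tau hL hN hfix ε t ha
  rw [him] at h1
  exact ⟨t + N, by omega, by rw [Set.image_congr hadd, him], hadd a ha.left_mem,
    (hadd a' ha.right_mem).trans (h1.right_unique hb)⟩

/-- If a vertex is mapped to the next one by an iterate of `σ₃` that preserves `V`, then so is any
vertex to any other one. -/
lemma SignEquivalent.one_of_cons (hV : IsPrePolygon L V) (hL : IsInvariantLamination 3 L)
    (hN : 0 < N) (hfix : ∀ z ∈ V, (sigma 3)^[N] z = z) {x y : Circle}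
    (hxy : Cons V x y) (h : SignEquivalent V 1 x y) {v w : Circle} (hv : v ∈ V) (hw : w ∈ V) :
    SignEquivalent V 1 v w := by
  have hone : IsSign 1 := Or.inl rfl
  have hall : ∀ z ∈ V, SignEquivalent V 1 x z := by
    refine hV.cons_induction hxy.left_mem ⟨0, by simp [tau_one], by simp [tau_one]⟩
      fun a b hab ha => ?_
    obtain ⟨t, -, him, -, hb⟩ := ha.cons hV hL hN hfix hxy hab
    simpa using h.trans hone ⟨t, him, hb⟩
  simpa using ((hall v hv).symm hN hfix hone hxy.left_mem).trans hone (hall w hw)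

/-- With sign `1` the group consists of powers of the first return map, since exponents preserving
`V` are multiples of `k`. -/
lemma signEquivalent_one_iff (hg : (sigma 3)^[k] '' V = V)
    (hk : ∀ t, (sigma 3)^[t] '' V = V → k ∣ t) {u v : Circle} :
    SignEquivalent V 1 u v ↔ ∃ j, ((sigma 3)^[k])^[j] u = v := by
  simp only [SignEquivalent, tau_one, ← Function.iterate_mul]
  constructor
  · rintro ⟨t, him, rfl⟩
    obtain ⟨j, rfl⟩ := hk t him
    exact ⟨j, rfl⟩
  · rintro ⟨j, rfl⟩
    refine ⟨k * j, ?_, rfl⟩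
    rw [Function.iterate_mul]
    induction j with
    | zero => simp
    | succ j ih => rw [Function.iterate_succ, Set.image_comp, hg, ih]

lemma Cons.eq_of_sym2_eq (hV : IsPrePolygon L V) {a a' b b' : Circle} (ha : Cons V a a')
    (hb : Cons V b b') (h : s(a, a') = s(b, b')) : a = b := by
  rcases Sym2.eq_iff.1 h with h | ⟨rfl, rfl⟩
  · exact h.1
  · exact absurd hb (hV.not_cons_swap ha)

end CubicLam

end

/-! ### The dichotomy for periodic polygons -/

theorem mainTheorem6 (L : Set (Sym2 Circle)) (hL : CubicLam.IsSymmetricLamination L)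
    (G : Set ℂ) (hG : CubicLam.IsPeriodicPolygon L G) :
    (CubicLam.IsPeriodicOrbit (CubicLam.firstReturnChord G) (CubicLam.edges L G) ∧
      CubicLam.ActsAsRationalRotation L G (CubicLam.firstReturn G)) ∨
    ((∃ O₁ O₂ : Set (Sym2 Circle), O₁ ∪ O₂ = CubicLam.edges L G ∧ Disjoint O₁ O₂ ∧
        CubicLam.IsPeriodicOrbit (CubicLam.firstReturnChord G) O₁ ∧
        CubicLam.IsPeriodicOrbit (CubicLam.firstReturnChord G) O₂) ∧
      (∃ j : ℕ, 0 < j ∧ (CubicLam.sigmaGap 3)^[j] G = -G) ∧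
      ∀ e ∈ CubicLam.edges L G, ∀ e' ∈ CubicLam.edges L G, CubicLam.Adjacent e e' →
        ∃ j : ℕ, 0 < j ∧ (CubicLam.sigmaGap 3)^[j] G = -G ∧
          (CubicLam.sigmaChord 3)^[j] e = CubicLam.negChord e' ∧
          CubicLam.negChord e' ∈ CubicLam.edges L (-G)) := by
  open CubicLam in
  have hLi := hL.toIsInvariantLamination
  have hull_eq := hG.eq_hull
  have hV := isPolygon_vertices hLi.toIsLamination hG.isGap hull_eq hG.finite
  have hedges : ∀ e, e ∈ edges L G ↔ ∃ a b, Cons (vertices G) a b ∧ e = s(a, b) :=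
    fun e => mem_edges_iff hLi.toIsLamination hG.isGap hull_eq hG.finite
  have hgap := sigmaGap_iterate_eq_hull hull_eq
  have hret : firstReturn G = (sigma 3)^[Function.minimalPeriod (sigmaGap 3) G] := rfl
  have hretC : firstReturnChord G = Sym2.map (firstReturn G) := rfl
  have hkpos : 0 < Function.minimalPeriod (sigmaGap 3) G := by
    obtain ⟨m, hm, hm'⟩ := hG.periodic
    exact Function.minimalPeriod_pos_of_mem_periodicPts ⟨m, hm, hm'⟩
  have hgV : (sigma 3)^[Function.minimalPeriod (sigmaGap 3) G] '' vertices G = vertices G := by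
    rw [← vertices_sigmaGap_iterate, Function.iterate_minimalPeriod]
  have hk : ∀ t, (sigma 3)^[t] '' vertices G = vertices G →
      Function.minimalPeriod (sigmaGap 3) G ∣ t := fun t ht => by
    refine Function.IsPeriodicPt.minimalPeriod_dvd ?_
    change (sigmaGap 3)^[t] G = G
    rw [hgap, ht, ← hull_eq]
  set V := vertices G with hVdef
  obtain ⟨M, hM, hMfix⟩ := exists_iterate_eq_self hG.finite hgV
  rw [← hret] at hgV hMfix
  have hiff : ∀ {u v}, SignEquivalent V 1 u v ↔ ∃ j, (firstReturn G)^[j] u = v :=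
    signEquivalent_one_iff hgV hk
  obtain ⟨N, hN, hfix⟩ : ∃ N, 0 < N ∧ ∀ z ∈ V, (sigma 3)^[N] z = z :=
    ⟨_ * M, Nat.mul_pos hkpos hM, fun z hz => by
      rw [Function.iterate_mul, ← hret]; exact hMfix z hz⟩
  have hone : IsSign 1 := Or.inl rfl
  have hneg : IsSign (-1) := Or.inr rfl
  have hgcons : ∀ {a b}, Cons V a b → Cons V (firstReturn G a) (firstReturn G b) :=
    fun {a b} h => by
      have := hV.cons_tau hLi hN hfix 1 (Function.minimalPeriod (sigmaGap 3) G) h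
      rwa [tau_one, ← hret, hgV] at this
  have hgcons' : ∀ {a b} j, Cons V a b → Cons V ((firstReturn G)^[j] a) ((firstReturn G)^[j] b) :=
    fun {a b} j h => by
      induction j with
      | zero => exact h
      | succ j ih =>
        rw [Function.iterate_succ_apply', Function.iterate_succ_apply']
        exact hgcons ih
  have horbit : ∀ {a b}, Cons V a b → IsPeriodicOrbit (firstReturnChord G)
      (Set.range fun j => (firstReturnChord G)^[j] s(a, b)) := fun {a b} h =>
    isPeriodicOrbit_range hM (by
      rw [hretC, sym2_map_iterate, hMfix a h.left_mem, hMfix b h.right_mem])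
  have hmem : ∀ {a b c d}, Cons V a b → Cons V c d → SignEquivalent V 1 a c →
      s(c, d) ∈ Set.range fun j => (firstReturnChord G)^[j] s(a, b) := by
    intro a b c d hab hcd h
    obtain ⟨j, rfl⟩ := hiff.1 h
    refine ⟨j, ?_⟩
    simp only
    rw [hretC, sym2_map_iterate, (hgcons' j hab).right_unique hcd]
  have hsub : ∀ {a b}, Cons V a b →
      (Set.range fun j => (firstReturnChord G)^[j] s(a, b)) ⊆ edges L G := by
    rintro a b hab _ ⟨j, rfl⟩
    exact (hedges _).2 ⟨_, _, hgcons' j hab, by simp only [hretC, sym2_map_iterate]⟩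
  obtain ⟨p₀, hp₀, -⟩ := hV.three 1 1
  -- Whether the powers of the first return map alone are transitive on the vertices.
  by_cases htrans : ∀ v ∈ V, ∀ w ∈ V, SignEquivalent V 1 v w
  · left
    obtain ⟨p₁, hp⟩ := hV.exists_next hp₀
    constructor
    · have : edges L G = Set.range fun j => (firstReturnChord G)^[j] s(p₀, p₁) := by
        refine Set.Subset.antisymm (fun e he => ?_) (hsub hp)
        obtain ⟨a, b, hab, rfl⟩ := (hedges e).1 he
        exact hmem hp hab (htrans _ hp₀ _ hab.left_mem)
      rw [this]
      exact horbit hp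
    · obtain ⟨n, θ, hn, hmono, hper, hθ⟩ := exists_enumeration hG.finite ⟨p₀, hp₀⟩
      have hcons := cons_enumeration hn hmono hper hθ
        (fun a => (hV.three a a).imp fun c hc => ⟨hc.1, hc.2.1⟩)
      have h0 : firstReturn G (Circle.exp (θ 0)) ∈ V := (hgcons (hcons 0)).left_mem
      rw [hVdef, hθ] at h0
      obtain ⟨p, hp⟩ := h0
      refine ⟨n, p, θ, hn, hmono, hper, hθ, ?_, fun i => ?_⟩
      · ext e
        rw [hedges]
        constructor
        · rintro ⟨a, b, hab, rfl⟩
          have ha := hab.left_mem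
          rw [hVdef, hθ] at ha
          obtain ⟨i, rfl⟩ := ha
          exact ⟨i, by rw [hab.right_unique (hcons i)]⟩
        · rintro ⟨i, rfl⟩
          exact ⟨_, _, hcons i, rfl⟩
      -- The shift `p` is fixed by the image of the vertex of index `0`; consecutive vertices have
      -- consecutive images, which propagates it in both directions.
      · induction i using Int.induction_on with
        | zero => rw [zero_add]; exact hp.symm
        | succ i ih =>
          have h1 := hgcons (hcons i)
          have h2 := hcons (i + p)
          rw [ih] at h1
          rw [show (i : ℤ) + 1 + p = i + p + 1 by ring]
          exact h1.right_unique h2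
        | pred i ih =>
          have h1 := hgcons (hcons (-i - 1))
          have h2 := hcons (-i - 1 + p)
          rw [sub_add_cancel, ih] at h1
          rw [show -(i : ℤ) - 1 + p + 1 = -i + p by ring] at h2
          exact h1.left_unique h2
  · right
    push Not at htrans
    obtain ⟨v, hv, w, hw, hvw⟩ := htrans
    -- This is where transitivity of the group with signs enters.
    have hdich : ∀ {a b}, a ∈ V → b ∈ V → SignEquivalent V 1 a b ∨ SignEquivalent V (-1) a b :=
      fun {a b} ha hb => by
        obtain ⟨ε, rfl | rfl, h⟩ := hV.equivalent hL hN hfix ha hb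
        exacts [Or.inl h, Or.inr h]
    have hgapneg : ∀ {t}, tau (-1) t '' V = V → (sigmaGap 3)^[t] G = -G := fun {t} h => by
      rw [hgap]
      conv_rhs => rw [hull_eq, neg_hull, ← h, Set.image_image]
      simp [tau]
    have hwv : SignEquivalent V (-1) w v :=
      ((hdich hv hw).resolve_left hvw).symm hN hfix hneg hv
    obtain ⟨v', hv'⟩ := hV.exists_next hv
    obtain ⟨w', hw'⟩ := hV.exists_next hw
    refine ⟨⟨_, _, ?_, ?_, horbit hv', horbit hw'⟩, ?_, ?_⟩
    · refine Set.Subset.antisymm (Set.union_subset (hsub hv') (hsub hw')) fun e he => ?_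
      obtain ⟨a, b, hab, rfl⟩ := (hedges e).1 he
      rcases hdich hv hab.left_mem with h | h
      · exact Or.inl (hmem hv' hab h)
      -- Two sign changes compose to sign `1`, so there is no third orbit.
      · exact Or.inr (hmem hw' hab (by simpa using hwv.trans hneg h))
    · rw [Set.disjoint_left]
      rintro _ ⟨i, rfl⟩ ⟨j, hij⟩
      simp only [hretC, sym2_map_iterate] at hij
      have h1 := Cons.eq_of_sym2_eq hV.toIsPrePolygon (hgcons' j hw') (hgcons' i hv') hij
      have h2 : SignEquivalent V 1 v ((firstReturn G)^[j] w) := hiff.2 ⟨i, h1.symm⟩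
      have h3 := (hiff.2 ⟨j, rfl⟩ : SignEquivalent V 1 w ((firstReturn G)^[j] w)).symm hN hfix hone
        hw
      exact hvw (by simpa using h2.trans hone h3)
    · obtain ⟨t, ht, him, -⟩ := hwv.cons hV.toIsPrePolygon hLi hN hfix hw' hv'
      exact ⟨t, ht, hgapneg him⟩
    · intro e he e' he' hadj
      obtain ⟨a, a', ha, rfl⟩ := (hedges e).1 he
      obtain ⟨b, b', hb, rfl⟩ := (hedges e').1 he'
      have hnot : ∀ {x y}, Cons V x y → ¬ SignEquivalent V 1 x y := fun {x y} hxy h =>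
        hvw (h.one_of_cons hV.toIsPrePolygon hLi hN hfix hxy hv hw)
      -- Distinct sides sharing an endpoint start at neighbouring vertices, and sign `1` between
      -- neighbours would make the first return map transitive.
      have hne : ¬ SignEquivalent V 1 a b := by
        intro h
        obtain ⟨hee, z, hz, hz'⟩ := hadj
        have hab : a ≠ b := by
          rintro rfl
          exact hee (by rw [ha.right_unique hb])
        rcases Sym2.mem_iff.1 hz with rfl | rfl <;> rcases Sym2.mem_iff.1 hz' with h' | h'
        · exact hab h'
        · subst h'
          exact hnot hb (h.symm hN hfix hone ha.left_mem)
        · subst h'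
          exact hnot ha h
        · subst h'
          exact hab (ha.left_unique hb)
      obtain ⟨t, ht, him, hta, hta'⟩ := ((hdich ha.left_mem hb.left_mem).resolve_left hne).cons
        hV.toIsPrePolygon hLi hN hfix ha hb
      refine ⟨t, ht, hgapneg him, ?_, negChord_mem_edges hL he'⟩
      rw [sigmaChord, sym2_map_iterate, ← hta, ← hta', negChord, Sym2.map_mk]
      simp [tau]
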